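/- Let $d\ge 2$ be an integer and let $G$ be a real-valued, real-analytic function on $(-1,1)$ with a zero of order at least $d+1$ at $0$. Let $\ell^1=\ell^1(\mathbb Z^2,\mathbb C)$ with $\|u\|_{\ell^1}=\sum_k|u_k|$, let $B(\eta)=\{u\in\ell^1:\|u\|_{\ell^1}\le\eta\}$, and equip $\ell^1$ with the symplectic form $\Omega=\frac{\mathrm i}{2}\sum_{k\in\mathbb Z^2}du_k\wedge d\bar u_k$. The Hamiltonian vector field of a real-valued function $R$ is $(X_R)_k=2\mathrm i\,\partial_{\bar a_k}R$. Consider the Fourier NLS Hamiltonian $\mathcal H=\mathcal D+\mathcal G$ on $\mathbb T^2=(\mathbb R/2\pi\mathbb Z)^2$, $$\mathcal D(u)=\frac12\sum_{k\in\mathbb Z^2}|k|^2|u_k|^2,\qquad \mathcal G(u)=\sum_{\substack{k_1,\dots,k_{2d}\in\mathbb Z^2\\ \sum_i(-1)^ik_i=0}}u_{k_1}\bar u_{k_2}\cdots u_{k_{2d-1}}\bar u_{k_{2d}}+\int_{\mathbb T^2}G(|u(x)|^2)\frac{dx}{(2\pi)^2},$$ where $u(x)=\sum_k u_ke^{\mathrm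 i(k,x)}$; $\mathcal H$ is defined at the $u\in\ell^1$ with $\|u\|_{\ell^1}<1$ and $\sum_k|k|^2|u_k|^2<\infty$. There exist $\eta\in(0,1/2)$, a symplectic change of coordinates $\Gamma:B(\eta)\to B(2\eta)$ (the restriction of a smooth diffeomorphism between open subsets of $\ell^1$, the first of which contains $B(\eta)$, with $\Omega(D\Gamma(a)v,D\Gamma(a)w)=\Omega(v,w)$ for all $a\in B(\eta)$ and $v,w\in\ell^1$), a real-valued function $\mathcal R$, smooth on a neighbourhood of $B(\eta)$, and a constant $C$ such that the following holds for all $a\in B(\eta)$. 1. $\sum_k|k|^2|\Gamma(a)_k|^2<\infty$ if and only if $\sum_k|k|^2|a_k|^2<\infty$, and in this case $$\mathcal H(\Gamma(a))=\mathcal D(a)+H_{\rm Res}(a)+\mathcal R(a),$$ where $H_{\rm Res}$ contains only resonant monomials of degree $2d$, namely $$H_{\rm Res}(a)=\sum_{\substack{k_1,\dots,k_{2d}\in\mathbb Z^2\\ \sum_i(-1)^ik_i=0,\ \sum_i(-1)^i|k_i|^2=0}}a_{k_1}\bar a_{k_2}\cdots a_{k_{2d-1}}\bar a_{k_{2d}}.$$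 Moreover, for all $a\in B(\eta)$, $$H_{\rm Res}(a)=\sum_{\substack{\alpha,\beta:\mathbb Z^2\to\mathbb N,\ |\alpha|=|\beta|=d\\ \sum_k(\alpha_k-\beta_k)k=0,\ \sum_k(\alpha_k-\beta_k)|k|^2=0}}\binom d\alpha\binom d\beta a^\alpha\bar a^\beta,\qquad \binom d\alpha=\frac{d!}{\prod_k\alpha_k!}.$$ 2. $X_{\mathcal R}(a)\in\ell^1$ and $\|X_{\mathcal R}(a)\|_{\ell^1}\le C\|a\|_{\ell^1}^{2d+1}$. 3. $\|\Gamma(a)-a\|_{\ell^1}\le C\|a\|_{\ell^1}^{2d-1}$. -/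

import Mathlib

open scoped ComplexConjugate ContDiff

noncomputable section

namespace FourierNLS

/-- The lattice `ℤ²` of Fourier modes. -/
abbrev Z2 : Type := Fin 2 → ℤ

/-- The squared Euclidean length `|k|²` of a mode. -/
def sqLen (k : Z2) : ℤ := ∑ j, k j ^ 2

/-- The Banach space `ℓ¹(ℤ², ℂ)`, with norm `‖u‖ = ∑ₖ |uₖ|`. -/
abbrev L1 : Type := lp (fun _ : Z2 => ℂ) 1

/-- The function `u(x) = ∑ₖ uₖ e^{i (k, x)}` with Fourier coefficients `uₖ`. -/
def toFun (u : L1) (x : Fin 2 → ℝ) : ℂ :=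
  ∑' k : Z2, u k * Complex.exp (Complex.I * ∑ j, (k j : ℂ) * (x j : ℂ))

/-- Finite kinetic energy: the series that defines the quadratic Hamiltonian converges. -/
def FiniteEnergy (u : L1) : Prop := Summable fun k : Z2 => (sqLen k : ℝ) * ‖u k‖ ^ 2

/-- The quadratic Hamiltonian `𝒟(u) = ½ ∑ₖ |k|² |uₖ|²` (meaningful if `FiniteEnergy u`). -/
def quadHam (u : L1) : ℝ := 1 / 2 * ∑' k : Z2, (sqLen k : ℝ) * ‖u k‖ ^ 2

/-- The monomial `u_{k₁} ū_{k₂} u_{k₃} ū_{k₄} ⋯ u_{k_{2d-1}} ū_{k_{2d}}`.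
The index `i : Fin (2 * d)` stands for position `i + 1`. -/
def monomial (d : ℕ) (u : L1) (k : Fin (2 * d) → Z2) : ℂ :=
  ∏ i : Fin (2 * d), if Odd ((i : ℕ) + 1) then u (k i) else conj (u (k i))

/-- Momentum conservation `∑ᵢ (-1)ⁱ kᵢ = 0`. -/
def ZeroMomentum (d : ℕ) (k : Fin (2 * d) → Z2) : Prop :=
  ∑ i : Fin (2 * d), (-1 : ℤ) ^ ((i : ℕ) + 1) • k i = 0

/-- The resonance condition `∑ᵢ (-1)ⁱ kᵢ = 0` and `∑ᵢ (-1)ⁱ |kᵢ|² = 0`. -/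
def Resonant (d : ℕ) (k : Fin (2 * d) → Z2) : Prop :=
  ZeroMomentum d k ∧ ∑ i : Fin (2 * d), (-1 : ℤ) ^ ((i : ℕ) + 1) * sqLen (k i) = 0

/-- The nonlinear part: the sum of all monomials of degree `2d` with zero momentum, plus
`∫_{𝕋²} G(|u|²) dx / (2π)²`, where `𝕋² = (ℝ / 2πℤ)²`. -/
def nonlinHam (d : ℕ) (G : ℝ → ℝ) (u : L1) : ℂ :=
  (∑' k : {k : Fin (2 * d) → Z2 // ZeroMomentum d k}, monomial d u k) +
    (((1 / (2 * Real.pi) ^ 2) *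
      ∫ x in Set.Icc (0 : Fin 2 → ℝ) (fun _ => 2 * Real.pi), G (‖toFun u x‖ ^ 2) : ℝ) : ℂ)

/-- The full Hamiltonian `ℋ = 𝒟 + 𝒢` in Fourier coordinates. -/
def nlsHam (d : ℕ) (G : ℝ → ℝ) (u : L1) : ℂ := (quadHam u : ℂ) + nonlinHam d G u

/-- The resonant Hamiltonian `H_Res`: the sum of all resonant monomials of degree `2d`. -/
def resHam (d : ℕ) (a : L1) : ℂ :=
  ∑' k : {k : Fin (2 * d) → Z2 // Resonant d k}, monomial d a k

/-- The resonance condition for a pair of finitely supported multi-indices `α, β : ℤ² → ℕ`: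
`|α| = |β| = d`, `∑ₖ (αₖ - βₖ) k = 0` and `∑ₖ (αₖ - βₖ) |k|² = 0`. -/
def ResonantIndex (d : ℕ) (p : (Z2 →₀ ℕ) × (Z2 →₀ ℕ)) : Prop :=
  (p.1.sum fun _ n => n) = d ∧ (p.2.sum fun _ n => n) = d ∧
  ∑ k ∈ p.1.support ∪ p.2.support, ((p.1 k : ℤ) - (p.2 k : ℤ)) • k = 0 ∧
  ∑ k ∈ p.1.support ∪ p.2.support, ((p.1 k : ℤ) - (p.2 k : ℤ)) * sqLen k = 0

/-- The resonant sum in multi-index form, `∑ binom(d, α) binom(d, β) a^α ā^β`,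
with multinomial coefficients `binom(d, α) = d! / ∏ₖ αₖ!`. -/
def resHamMulti (d : ℕ) (a : L1) : ℂ :=
  ∑' p : {p : (Z2 →₀ ℕ) × (Z2 →₀ ℕ) // ResonantIndex d p},
    (p.1.1.multinomial : ℂ) * (p.1.2.multinomial : ℂ) *
      (p.1.1.prod fun k n => a k ^ n) * (p.1.2.prod fun k n => conj (a k) ^ n)

/-- The symplectic form `Ω = (i/2) ∑ₖ duₖ ∧ dūₖ` on `ℓ¹`. -/
def symplForm (v w : L1) : ℂ :=
  Complex.I / 2 * ∑' k : Z2, (v k * conj (w k) - w k * conj (v k))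

/-- The Wirtinger derivative `∂R / ∂āₖ = ½ (∂R/∂xₖ + i ∂R/∂yₖ)`, where `aₖ = xₖ + i yₖ`. -/
def wirtingerBar (R : L1 → ℝ) (a : L1) (k : Z2) : ℂ :=
  1 / 2 * ((fderiv ℝ R a (lp.single 1 k (1 : ℂ)) : ℂ) +
    Complex.I * (fderiv ℝ R a (lp.single 1 k Complex.I) : ℂ))

/-- The `k`-th component `2 i ∂R / ∂āₖ` of the Hamiltonian vector field `X_R`. -/
def hamField (R : L1 → ℝ) (a : L1) (k : Z2) : ℂ :=
  2 * Complex.I * wirtingerBar R a k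

end FourierNLS

end

open scoped ComplexConjugate ContDiff

noncomputable section

namespace FourierNLS

/-! ### Summation over tuples -/

/-! The non-resonant monomials are removed by an auxiliary Hamiltonian χ of degree 2d. Instead of
the time-one flow of X = X_χ, one step of the implicit midpoint rule is used, the Cayley transform:
m solves m − X(m)/2 = a, and Γ(a) = m + X(m)/2. Since DX(m) is antisymmetric for Ω, Γ is symplectic
(`sympl_fderiv_antisymm`, `sympl_cayley`). Since 𝒟 is quadratic, 𝒟(Γ a) − 𝒟(a) is exactly the
derivative of 𝒟 along X at m, with no higher-order terms (`wq_cayley`, `hasSum_rotate_polyField`).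

The coefficients of χ are i/Δ(k) off the resonances, where Δ is the resonance function. It takes
integer values, so there are no small divisors. With Z the resonant sum and P the sum of all neutral
monomials of degree 2d, that derivative is Z(m) − P(m) (`tsum_homological`). If g is the term coming
from G, then ℋ(Γ a) = 𝒟(a) + Z(a) + [Z(m) − Z(a) + P(Γ a) − P(m) + g(Γ a)], and the bracket is the
remainder. Both m − a and Γ a − m equal X(m)/2 = O(‖a‖^(2d−1)), and the fields of Z and P have
Lipschitz constant O(‖a‖^(2d−2)) there, so the differences contribute O(‖a‖^(4d−3)), which is
O(‖a‖^(2d+1)) because d ≥ 2; g contributes O(‖a‖^(2d+1)) (`hasFDerivAt_remainder`,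
`norm_remainder_le`).

The ℓ¹ estimates rest on one fact: a neutral tuple is determined by all but one of its modes, so the
gradient of a form with bounded coefficients is an ℓ¹-valued multilinear map (`polyForm_update`).

As 𝒟 is unbounded on ℓ¹, the energy identity is first proved with |k|² replaced by min(|k|, N)². The
truncation keeps the triangle inequality along neutral tuples, hence bounds uniform in N
(`summable_subadd`, `wq_trunc_cayley_le`); then N → ∞ by dominated convergence (`quadHam_cayley`).
-/

theorem tendsto_piFinset_atTop {ι β : Type*} [Fintype ι] [DecidableEq ι] :
    Filter.Tendsto (fun t : Finset β => Fintype.piFinset fun _ : ι => t) Filter.atTop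
      Filter.atTop := by
  classical
  refine Filter.tendsto_atTop_finset_of_monotone (fun s t h => ?_) fun x => ?_
  · exact Fintype.piFinset_subset _ _ fun _ => h
  · exact ⟨Finset.univ.image x, by simp⟩

theorem summable_prod_of_nonneg {ι β : Type*} [Fintype ι] {f : ι → β → ℝ}
    (h0 : ∀ i b, 0 ≤ f i b) (hf : ∀ i, Summable (f i)) :
    Summable fun k : ι → β => ∏ i, f i (k i) := by
  classical
  refine summable_of_sum_le (c := ∏ i, ∑' b, f i b)
    (fun k => Finset.prod_nonneg fun i _ => h0 i _) fun s => ?_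
  have hs : s ⊆ Fintype.piFinset fun i => s.image fun k => k i := fun k hk => by
    simpa using fun i => ⟨k, hk, rfl⟩
  calc ∑ k ∈ s, ∏ i, f i (k i)
      ≤ ∑ k ∈ Fintype.piFinset fun i => s.image fun k => k i, ∏ i, f i (k i) :=
        Finset.sum_le_sum_of_subset_of_nonneg hs fun k _ _ =>
          Finset.prod_nonneg fun i _ => h0 i _
    _ = ∏ i, ∑ b ∈ s.image fun k => k i, f i b := (Finset.prod_univ_sum _ _).symm
    _ ≤ _ := Finset.prod_le_prod (fun i _ => Finset.sum_nonneg fun b _ => h0 i b)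
        fun i _ => (hf i).sum_le_tsum _ fun b _ => h0 i b

/-- Absolute convergence allows the sum to be computed along the cubes tᶥ, where the finite
distributive law turns each partial sum into a product of partial sums. -/
theorem hasSum_prod {ι β R : Type*} [Fintype ι] [NormedCommRing R] [NormMulClass R]
    [NormOneClass R] [CompleteSpace R]
    {f : ι → β → R} (hf : ∀ i, Summable fun b => ‖f i b‖) :
    HasSum (fun k : ι → β => ∏ i, f i (k i)) (∏ i, ∑' b, f i b) := by
  classical
  have hs : Summable fun k : ι → β => ∏ i, f i (k i) := by
    refine Summable.of_norm ?_
    have := summable_prod_of_nonneg (f := fun i b => ‖f i b‖) (fun _ _ => norm_nonneg _) hf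
    refine this.congr fun k => ?_
    induction (Finset.univ : Finset ι) using Finset.induction_on with
    | empty => simp
    | insert a s ha ih => rw [Finset.prod_insert ha, Finset.prod_insert ha, norm_mul, ih]
  have h1 := hs.hasSum.comp (tendsto_piFinset_atTop (ι := ι) (β := β))
  have h2 : Filter.Tendsto (fun t : Finset β => ∏ i, ∑ b ∈ t, f i b) Filter.atTop
      (nhds (∏ i, ∑' b, f i b)) :=
    tendsto_finsetProd _ fun i _ => (hf i).of_norm.hasSum
  have h3 : ((fun s : Finset (ι → β) => ∑ k ∈ s, ∏ i, f i (k i)) ∘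
      fun t : Finset β => Fintype.piFinset fun _ : ι => t) =
      fun t : Finset β => ∏ i, ∑ b ∈ t, f i b := by
    funext t
    exact (Finset.prod_univ_sum _ _).symm
  rw [h3] at h1
  rw [← tendsto_nhds_unique h1 h2]
  exact hs.hasSum

/-! ### The space `ℓ¹` -/

theorem summable_norm (u : L1) : Summable fun k => ‖u k‖ := by
  simpa using (lp.memℓp u).summable (by simp)

theorem norm_eq_tsum (u : L1) : ‖u‖ = ∑' k, ‖u k‖ := by
  rw [lp.norm_eq_tsum_rpow (by simp)]; simp

theorem norm_apply_le (u : L1) (k : Z2) : ‖u k‖ ≤ ‖u‖ :=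
  lp.norm_apply_le_norm (by simp) u k

/-- The element of `ℓ¹` with given absolutely summable coordinates. -/
def ofSummable (f : Z2 → ℂ) (hf : Summable fun k => ‖f k‖) : L1 :=
  ⟨f, (memℓp_gen (by simpa using hf) : Memℓp (E := fun _ : Z2 => ℂ) f 1)⟩

/-- Multiplication of the coordinates by a bounded function. -/
def mulWeight (c : Z2 → ℂ) (C : ℝ) (hc : ∀ k, ‖c k‖ ≤ C) (u : L1) : L1 :=
  ofSummable (fun k => c k * u k) <| by
    refine ((summable_norm u).mul_left C).of_nonneg_of_le (fun _ => norm_nonneg _) fun k => ?_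
    rw [norm_mul]
    exact mul_le_mul_of_nonneg_right (hc k) (norm_nonneg _)

@[simp]
theorem mulWeight_apply (c : Z2 → ℂ) (C : ℝ) (hc : ∀ k, ‖c k‖ ≤ C) (u : L1) (k : Z2) :
    mulWeight c C hc u k = c k * u k := rfl

/-- `u` at the odd positions (`Odd (i + 1)`) and `ū` at the even ones. -/
def altL (i : ℕ) : L1 →L[ℝ] L1 :=
  if Odd (i + 1) then ContinuousLinearMap.id ℝ L1 else (starL' ℝ : L1 ≃L[ℝ] L1)

theorem altL_apply (i : ℕ) (u : L1) (k : Z2) :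
    altL i u k = if Odd (i + 1) then u k else conj (u k) := by
  unfold altL; split_ifs <;> rfl

theorem norm_altL_apply (i : ℕ) (u : L1) (k : Z2) : ‖altL i u k‖ = ‖u k‖ := by
  rw [altL_apply]; split_ifs <;> simp

@[simp]
theorem norm_altL (i : ℕ) (u : L1) : ‖altL i u‖ = ‖u‖ := by
  simp only [norm_eq_tsum, norm_altL_apply]

/-! ### Multilinear maps with bounded coefficients -/

section Lift

variable {ι : Type*} [Fintype ι]

theorem hasSum_norm_prod (U : ι → L1) :
    HasSum (fun k : ι → Z2 => ∏ i, ‖U i (k i)‖) (∏ i, ‖U i‖) := by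
  simp only [norm_eq_tsum]
  exact hasSum_prod (f := fun i b => ‖U i b‖) fun i => by simpa using summable_norm (U i)

variable {E : Type*} [NormedAddCommGroup E] [NormedSpace ℂ E]

theorem summable_tuple {A : (ι → Z2) → E} (hA : ∀ k, ‖A k‖ ≤ 1) (U : ι → L1) :
    Summable fun k : ι → Z2 => ‖(∏ i, U i (k i)) • A k‖ := by
  refine (hasSum_norm_prod U).summable.of_nonneg_of_le (fun _ => norm_nonneg _) fun k => ?_
  rw [norm_smul, norm_prod]
  exact mul_le_of_le_one_right (Finset.prod_nonneg fun i _ => norm_nonneg _) (hA k)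

variable [NormedSpace ℝ E] [IsScalarTower ℝ ℂ E] [CompleteSpace E]

/-- The multilinear map `(uᵢ) ↦ ∑ₖ (∏ᵢ uᵢ(kᵢ)) A(k)`. -/
def tupleLift (A : (ι → Z2) → E) (hA : ∀ k, ‖A k‖ ≤ 1) :
    ContinuousMultilinearMap ℝ (fun _ : ι => L1) E :=
  MultilinearMap.mkContinuous
    { toFun := fun U => ∑' k : ι → Z2, (∏ i, U i (k i)) • A k
      map_update_add' := by
        intro inst U i x y
        rw [← (summable_tuple hA _).of_norm.tsum_add (summable_tuple hA _).of_norm]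
        refine tsum_congr fun k => ?_
        rw [← add_smul]
        congr 1
        simp only [Finset.prod_eq_mul_prod_sdiff_singleton_of_mem (Finset.mem_univ i),
          Function.update_self]
        rw [lp.coeFn_add, Pi.add_apply, add_mul]
        have h (z : L1) : ∏ j ∈ Finset.univ \ {i}, Function.update U i z j (k j) =
            ∏ j ∈ Finset.univ \ {i}, U j (k j) := Finset.prod_congr rfl fun j hj => by
          have : j ≠ i := by simpa using hj
          simp [Function.update_of_ne this]
        rw [h, h, h]
      map_update_smul' := by
        intro inst U i c x
        rw [← tsum_const_smul'']
        refine tsum_congr fun k => ?_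
        rw [← smul_assoc]
        congr 1
        simp only [Finset.prod_eq_mul_prod_sdiff_singleton_of_mem (Finset.mem_univ i),
          Function.update_self]
        rw [lp.coeFn_smul, Pi.smul_apply, smul_mul_assoc]
        congr 2
        refine Finset.prod_congr rfl fun j hj => ?_
        have : j ≠ i := by simpa using hj
        simp [Function.update_of_ne this] }
    1 <| by
      intro U
      rw [one_mul]
      refine tsum_of_norm_bounded (hasSum_norm_prod U) fun k => ?_
      rw [norm_smul, norm_prod]
      exact mul_le_of_le_one_right (Finset.prod_nonneg fun i _ => norm_nonneg _) (hA k)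

theorem hasSum_tupleLift {A : (ι → Z2) → E} (hA : ∀ k, ‖A k‖ ≤ 1) (U : ι → L1) :
    HasSum (fun k : ι → Z2 => (∏ i, U i (k i)) • A k) (tupleLift A hA U) :=
  (summable_tuple hA U).of_norm.hasSum

theorem norm_tupleLift_le {A : (ι → Z2) → E} (hA : ∀ k, ‖A k‖ ≤ 1) :
    ‖tupleLift A hA‖ ≤ 1 :=
  MultilinearMap.mkContinuous_norm_le _ zero_le_one _

end Lift

/-! ### The symplectic form -/

theorem summable_pairing (v x : L1) : Summable fun k => ‖conj (v k) * x k‖ := by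
  refine ((summable_norm x).mul_left ‖v‖).of_nonneg_of_le (fun _ => norm_nonneg _) fun k => ?_
  rw [norm_mul, RCLike.norm_conj]
  exact mul_le_mul_of_nonneg_right (norm_apply_le v k) (norm_nonneg _)

/-- The real symplectic form `Im ∑ₖ v̄ₖ xₖ`. -/
def sympl : L1 →L[ℝ] L1 →L[ℝ] ℝ :=
  LinearMap.mkContinuous₂
    (LinearMap.mk₂ ℝ (fun v x : L1 => (∑' k, conj (v k) * x k).im)
      (by
        intro u v x
        rw [← Complex.add_im, ← (summable_pairing u x).of_norm.tsum_add
          (summable_pairing v x).of_norm]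
        simp only [lp.coeFn_add, Pi.add_apply, map_add, add_mul])
      (by
        intro c v x
        rw [← Complex.smul_im, ← tsum_const_smul'']
        simp [lp.coeFn_smul, mul_assoc])
      (by
        intro u v x
        rw [← Complex.add_im, ← (summable_pairing u v).of_norm.tsum_add
          (summable_pairing u x).of_norm]
        simp only [lp.coeFn_add, Pi.add_apply, mul_add])
      (by
        intro c v x
        rw [← Complex.smul_im, ← tsum_const_smul'']
        simp [lp.coeFn_smul, mul_left_comm]))
    1 <| by
      intro v x
      rw [LinearMap.mk₂_apply, one_mul]
      refine (Complex.abs_im_le_norm _).trans ?_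
      rw [norm_eq_tsum x, ← tsum_mul_left]
      refine tsum_of_norm_bounded ((summable_norm x).mul_left ‖v‖).hasSum fun k => ?_
      rw [norm_mul, RCLike.norm_conj]
      exact mul_le_mul_of_nonneg_right (norm_apply_le v k) (norm_nonneg _)

theorem sympl_apply (v x : L1) : sympl v x = (∑' k, conj (v k) * x k).im := rfl

theorem norm_sympl_le : ‖sympl‖ ≤ 1 := LinearMap.mkContinuous₂_norm_le _ zero_le_one _

theorem abs_sympl_le (v x : L1) : |sympl v x| ≤ ‖v‖ * ‖x‖ := by
  have := sympl.le_opNorm₂ v x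
  rw [Real.norm_eq_abs] at this
  refine this.trans ?_
  nlinarith [norm_sympl_le, mul_nonneg (norm_nonneg v) (norm_nonneg x)]

theorem symplForm_eq (v w : L1) : symplForm v w = (sympl v w : ℂ) := by
  have h1 := (summable_pairing v w).of_norm
  have h2 : Summable fun k => v k * conj (w k) := by
    refine ((Complex.summable_conj).2 h1).congr fun k => ?_
    simp
  have h3 : Summable fun k => w k * conj (v k) := h1.congr fun k => mul_comm _ _
  have h4 : (∑' k, v k * conj (w k)) = conj (∑' k, conj (v k) * w k) := by
    rw [Complex.conj_tsum]
    exact tsum_congr fun k => by simp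
  have h5 : (∑' k, w k * conj (v k)) = ∑' k, conj (v k) * w k :=
    tsum_congr fun k => mul_comm _ _
  have : symplForm v w = Complex.I / 2 * ((∑' k, v k * conj (w k)) - ∑' k, w k * conj (v k)) := by
    rw [← h2.tsum_sub h3]; rfl
  rw [this, h4, h5, sympl_apply]
  apply Complex.ext
  · simp; ring
  · simp

theorem sympl_antisymm (v w : L1) : sympl v w = -sympl w v := by
  have : (∑' k, conj (v k) * w k) = conj (∑' k, conj (w k) * v k) := by
    rw [Complex.conj_tsum]
    exact tsum_congr fun k => by simp [mul_comm]
  rw [sympl_apply, sympl_apply, this, Complex.conj_im]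

theorem sympl_single (k : Z2) (z : ℂ) (x : L1) :
    sympl (lp.single 1 k z) x = (conj z * x k).im := by
  rw [sympl_apply, tsum_eq_single k]
  · simp
  · intro j hj
    rw [lp.single_apply_ne _ _ _ hj, map_zero, zero_mul]

/-- A function whose differential at `a` is `Ω(·, x)` has Hamiltonian vector field `x` at `a`. -/
theorem hamField_eq {R : L1 → ℝ} {a x : L1} (h : HasFDerivAt R (sympl.flip x) a) (k : Z2) :
    hamField R a k = x k := by
  rw [hamField, wirtingerBar, h.fderiv]
  simp only [ContinuousLinearMap.flip_apply, sympl_single]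
  apply Complex.ext <;> simp

/-! ### Polynomial Hamiltonians with zero momentum -/

/-- Momentum conservation for tuples of arbitrary length. -/
def Neutral {n : ℕ} (k : Fin n → Z2) : Prop :=
  ∑ i : Fin n, (-1 : ℤ) ^ ((i : ℕ) + 1) • k i = 0

open Classical in
/-- The coefficients `c`, restricted to the tuples with zero momentum. -/
def neutralCoeff {n : ℕ} (c : (Fin n → Z2) → ℂ) (k : Fin n → Z2) : ℂ :=
  if Neutral k then c k else 0

theorem norm_neutralCoeff_le {n : ℕ} {c : (Fin n → Z2) → ℂ} (hc : ∀ k, ‖c k‖ ≤ 1)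
    (k : Fin n → Z2) : ‖neutralCoeff c k‖ ≤ 1 := by
  unfold neutralCoeff; split_ifs
  · exact hc k
  · simp

/-- The multilinear form with the coefficients `c`. -/
def polyForm {n : ℕ} (c : (Fin n → Z2) → ℂ) (hc : ∀ k, ‖c k‖ ≤ 1) :
    ContinuousMultilinearMap ℝ (fun _ : Fin n => L1) ℂ :=
  tupleLift (neutralCoeff c) (norm_neutralCoeff_le hc)

/-- The Hamiltonian `∑ₖ c(k) u_{k₁} ū_{k₂} ⋯` over the tuples with zero momentum. -/
def polyHam {n : ℕ} (c : (Fin n → Z2) → ℂ) (hc : ∀ k, ‖c k‖ ≤ 1) (u : L1) : ℂ :=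
  polyForm c hc fun i => altL i u

/-- The monomial `u_{k₁} ū_{k₂} ⋯` with `n` factors. -/
def mono {n : ℕ} (u : L1) (k : Fin n → Z2) : ℂ := ∏ i : Fin n, altL i u (k i)

theorem hasSum_polyHam {n : ℕ} {c : (Fin n → Z2) → ℂ} (hc : ∀ k, ‖c k‖ ≤ 1) (u : L1) :
    HasSum (fun k => mono u k * neutralCoeff c k) (polyHam c hc u) :=
  hasSum_tupleLift _ _

/-- The momentum at position `i` that makes a tuple neutral. -/
def completion {n : ℕ} (i : Fin n) (k : {j // j ≠ i} → Z2) : Z2 :=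
  -((-1 : ℤ) ^ ((i : ℕ) + 1) • ∑ j, (-1 : ℤ) ^ ((j.1 : ℕ) + 1) • k j)

theorem neutral_iff {n : ℕ} (i : Fin n) (κ : Z2) (k : {j // j ≠ i} → Z2) :
    Neutral ((Equiv.funSplitAt i Z2).symm (κ, k)) ↔ κ = completion i k := by
  have h1 : ∑ j : Fin n, (-1 : ℤ) ^ ((j : ℕ) + 1) • (Equiv.funSplitAt i Z2).symm (κ, k) j =
      (-1 : ℤ) ^ ((i : ℕ) + 1) • κ + ∑ j : {j // j ≠ i}, (-1 : ℤ) ^ ((j.1 : ℕ) + 1) • k j := by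
    rw [Fintype.sum_eq_add_sum_subtype_ne _ i]
    congr 1
    · simp [Equiv.funSplitAt, Equiv.piSplitAt]
    · refine Finset.sum_congr rfl fun j _ => ?_
      simp [Equiv.funSplitAt, Equiv.piSplitAt, j.2]
  rw [Neutral, h1, completion]
  rcases neg_one_pow_eq_or ℤ ((i : ℕ) + 1) with h | h <;> rw [h]
  · rw [one_smul, one_smul]; exact add_eq_zero_iff_eq_neg
  · rw [neg_smul, neg_smul, one_smul, one_smul, neg_neg, neg_add_eq_zero]

/-- The field generated by the factor at position `i`. -/
def slotForm {n : ℕ} (c : (Fin n → Z2) → ℂ) (hc : ∀ k, ‖c k‖ ≤ 1) (i : Fin n) :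
    ContinuousMultilinearMap ℝ (fun _ : {j // j ≠ i} => L1) L1 :=
  tupleLift (fun k => lp.single 1 (completion i k)
    (c ((Equiv.funSplitAt i Z2).symm (completion i k, k)))) fun k => by
      rw [lp.norm_single (by simp)]; exact hc _

/-- The bilinear pairing `∑ₖ wₖ xₖ` as a function of `x`. -/
def pairL (w : L1) : L1 →L[ℝ] ℂ :=
  LinearMap.mkContinuous
    { toFun := fun x => ∑' k, w k * x k
      map_add' := by
        intro x y
        rw [← (summable_mul x).of_norm.tsum_add (summable_mul y).of_norm]
        simp only [lp.coeFn_add, Pi.add_apply, mul_add]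
      map_smul' := by
        intro r x
        rw [← tsum_const_smul'']
        simp [lp.coeFn_smul, mul_left_comm] }
    ‖w‖ <| by
      intro x
      rw [norm_eq_tsum x, ← tsum_mul_left]
      refine tsum_of_norm_bounded ((summable_norm x).mul_left ‖w‖).hasSum fun k => ?_
      rw [norm_mul]
      exact mul_le_mul_of_nonneg_right (norm_apply_le w k) (norm_nonneg _)
  where
    summable_mul (x : L1) : Summable fun k => ‖w k * x k‖ := by
      refine ((summable_norm x).mul_left ‖w‖).of_nonneg_of_le (fun _ => norm_nonneg _) fun k => ?_
      rw [norm_mul]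
      exact mul_le_mul_of_nonneg_right (norm_apply_le w k) (norm_nonneg _)

theorem pairL_apply (w x : L1) : pairL w x = ∑' k, w k * x k := rfl

theorem pairL_single (w : L1) (k : Z2) (z : ℂ) : pairL w (lp.single 1 k z) = w k * z := by
  rw [pairL_apply, tsum_eq_single k]
  · simp
  · intro j hj
    rw [lp.single_apply_ne _ _ _ hj, mul_zero]

/-- Summing over the mode in slot `i` first, neutrality leaves the single value `completion i k`.
What remains is a sum of unit vectors with absolutely summable weights, which is why the gradient
lies in ℓ¹ and not merely in its dual. -/
theorem polyForm_update {n : ℕ} {c : (Fin n → Z2) → ℂ} (hc : ∀ k, ‖c k‖ ≤ 1) (i : Fin n)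
    (U : Fin n → L1) (w : L1) :
    polyForm c hc (Function.update U i w) = pairL w (slotForm c hc i fun j => U j) := by
  let T := Equiv.funSplitAt i Z2
  have h1 := (pairL w).hasSum (hasSum_tupleLift (fun k => by
      rw [lp.norm_single (by simp)]; exact hc _ : ∀ k : {j // j ≠ i} → Z2,
        ‖(lp.single 1 (completion i k) (c (T.symm (completion i k, k))) : L1)‖ ≤ 1)
        fun j : {j // j ≠ i} => U j)
  have h2 := hasSum_tupleLift (norm_neutralCoeff_le hc) (Function.update U i w)
  rw [← T.symm.hasSum_iff, ← (Equiv.prodComm _ _).hasSum_iff] at h2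
  refine (h2.prod_fiberwise (g := fun k => (∏ j : {j // j ≠ i}, U j (k j)) *
    (w (completion i k) * c (T.symm (completion i k, k)))) fun k => ?_).unique ?_
  · have h3 (κ : Z2) : ∏ j, (Function.update U i w j) (T.symm (κ, k) j) =
        w κ * ∏ j : {j // j ≠ i}, U j (k j) := by
      rw [Fintype.prod_eq_mul_prod_subtype_ne _ i]
      congr 1
      · simp [T, Equiv.funSplitAt, Equiv.piSplitAt]
      · refine Finset.prod_congr rfl fun j _ => ?_
        simp [T, Equiv.funSplitAt, Equiv.piSplitAt, j.2]
    convert hasSum_single (completion i k) ?_ using 1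
    · simp only [Function.comp, Equiv.prodComm_apply, Prod.swap_prod_mk]
      rw [h3, neutralCoeff, if_pos ((neutral_iff i _ k).2 rfl), smul_eq_mul]
      ring
    · intro κ hκ
      simp only [Function.comp, Equiv.prodComm_apply, Prod.swap_prod_mk]
      rw [neutralCoeff, if_neg (mt (neutral_iff i _ k).1 hκ), smul_zero]
  · have h4 (z : ℂ) (x : L1) : pairL w (z • x) = z * pairL w x := by
      rw [pairL_apply, pairL_apply, ← tsum_mul_left]
      refine tsum_congr fun k => ?_
      rw [lp.coeFn_smul, Pi.smul_apply, smul_eq_mul, mul_left_comm]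
    simp only [h4, pairL_single] at h1
    exact h1

/-- Complex conjugation at the odd positions. -/
def coAltL (i : ℕ) : L1 →L[ℝ] L1 :=
  if Odd (i + 1) then (starL' ℝ : L1 ≃L[ℝ] L1) else ContinuousLinearMap.id ℝ L1

theorem coAltL_apply (i : ℕ) (u : L1) (k : Z2) :
    coAltL i u k = if Odd (i + 1) then conj (u k) else u k := by
  unfold coAltL; split_ifs <;> rfl

@[simp]
theorem norm_coAltL (i : ℕ) (u : L1) : ‖coAltL i u‖ = ‖u‖ := by
  simp only [norm_eq_tsum, coAltL_apply]
  refine tsum_congr fun k => ?_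
  split_ifs <;> simp

/-- Converts a partial derivative in slot `i`, given by the bilinear pairing, into the symplectic
form; the conjugation in `coAltL` compensates the one built into Ω. -/
theorem sympl_coAltL (i : ℕ) (v x : L1) :
    sympl v (Complex.I • coAltL i x) = (pairL (altL i v) x).re := by
  have h1 : (∑' k, conj (v k) * (Complex.I • coAltL i x) k) =
      Complex.I * ∑' k, conj (v k) * coAltL i x k := by
    rw [← tsum_mul_left]
    refine tsum_congr fun k => ?_
    rw [lp.coeFn_smul, Pi.smul_apply, smul_eq_mul, mul_left_comm]
  rw [sympl_apply, h1, pairL_apply, Complex.I_mul_im]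
  simp only [altL_apply, coAltL_apply]
  split_ifs
  · rw [← Complex.conj_re, Complex.conj_tsum]
    simp
  · rfl

/-- The Hamiltonian vector field of the real part of `polyHam c`. -/
def polyField {n : ℕ} (c : (Fin n → Z2) → ℂ) (hc : ∀ k, ‖c k‖ ≤ 1) (u : L1) : L1 :=
  ∑ i : Fin n, Complex.I • coAltL i (slotForm c hc i fun j => altL j u)

theorem contDiff_polyHam {n : ℕ} {c : (Fin n → Z2) → ℂ} (hc : ∀ k, ‖c k‖ ≤ 1) :
    ContDiff ℝ ω (polyHam c hc) :=
  (polyForm c hc).contDiff.comp (contDiff_pi.2 fun i => (altL i).contDiff)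

theorem sympl_polyField {n : ℕ} {c : (Fin n → Z2) → ℂ} (hc : ∀ k, ‖c k‖ ≤ 1) (u v : L1) :
    sympl v (polyField c hc u) = ∑ i : Fin n,
      (polyForm c hc (Function.update (fun j : Fin n => altL j u) i (altL i v))).re := by
  rw [polyField, map_sum]
  simp only [sympl_coAltL, polyForm_update]

theorem hasFDerivAt_polyHam {n : ℕ} {c : (Fin n → Z2) → ℂ} (hc : ∀ k, ‖c k‖ ≤ 1) (u : L1) :
    HasFDerivAt (fun u => (polyHam c hc u).re) (sympl.flip (polyField c hc u)) u := by
  have h1 : HasFDerivAt (fun u : L1 => fun i : Fin n => altL i u)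
      (ContinuousLinearMap.pi fun i : Fin n => altL i) u :=
    hasFDerivAt_pi.2 fun i => (altL i).hasFDerivAt
  have h2 := (Complex.reCLM.hasFDerivAt).comp u
    (((polyForm c hc).hasFDerivAt (fun i => altL i u)).comp u h1)
  refine h2.congr_fderiv ?_
  ext v
  simp only [ContinuousLinearMap.comp_apply, ContinuousMultilinearMap.linearDeriv_apply,
    ContinuousLinearMap.coe_pi', Complex.reCLM_apply, ContinuousLinearMap.flip_apply,
    sympl_polyField, Complex.re_sum]

theorem contDiff_polyField {n : ℕ} {c : (Fin n → Z2) → ℂ} (hc : ∀ k, ‖c k‖ ≤ 1) :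
    ContDiff ℝ ω (polyField c hc) := by
  refine ContDiff.sum fun i _ => ContDiff.const_smul _ ?_
  exact (coAltL i).contDiff.comp ((slotForm c hc i).contDiff.comp
    (contDiff_pi.2 fun j => (altL j).contDiff))

theorem norm_polyField_le {n : ℕ} {c : (Fin n → Z2) → ℂ} (hc : ∀ k, ‖c k‖ ≤ 1) (u : L1) :
    ‖polyField c hc u‖ ≤ n * ‖u‖ ^ (n - 1) := by
  refine (norm_sum_le_of_le (n := fun _ => ‖u‖ ^ (n - 1)) _ fun i _ => ?_).trans_eq (by simp)
  rw [norm_smul, Complex.norm_I, one_mul, norm_coAltL]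
  refine ((slotForm c hc i).le_opNorm _).trans ?_
  simp only [norm_altL, Finset.prod_const, Finset.card_univ, Fintype.card_subtype_compl,
    Fintype.card_fin, Fintype.card_unique]
  exact mul_le_of_le_one_left (by positivity) (norm_tupleLift_le _)

theorem norm_polyField_sub_le {n : ℕ} {c : (Fin n → Z2) → ℂ} (hc : ∀ k, ‖c k‖ ≤ 1) (u v : L1) :
    ‖polyField c hc u - polyField c hc v‖ ≤
      n * ((n - 1 : ℕ) * max ‖u‖ ‖v‖ ^ (n - 2) * ‖u - v‖) := by
  rw [polyField, polyField, ← Finset.sum_sub_distrib]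
  refine (norm_sum_le_of_le
    (n := fun _ => (n - 1 : ℕ) * max ‖u‖ ‖v‖ ^ (n - 2) * ‖u - v‖) _ fun i _ => ?_).trans_eq
    (by simp)
  rw [← smul_sub, ← map_sub, norm_smul, Complex.norm_I, one_mul, norm_coAltL]
  have hpi (w : L1) : ‖fun j : {j // j ≠ i} => altL j w‖ ≤ ‖w‖ :=
    (pi_norm_le_iff_of_nonneg (norm_nonneg _)).2 fun j => (norm_altL _ _).le
  have hpi' : ‖(fun j : {j // j ≠ i} => altL j u) - fun j : {j // j ≠ i} => altL j v‖ ≤ ‖u - v‖ :=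
    (pi_norm_le_iff_of_nonneg (norm_nonneg _)).2 fun j => by
      rw [Pi.sub_apply, ← map_sub, norm_altL]
  refine ((slotForm c hc i).norm_image_sub_le _ _).trans ?_
  have hcard : Fintype.card {j // j ≠ i} = n - 1 := by simp
  rw [hcard, show n - 1 - 1 = n - 2 by omega]
  have h1 : ‖slotForm c hc i‖ ≤ 1 := norm_tupleLift_le _
  gcongr
  · exact mul_le_of_le_one_left (by positivity) h1
  · exact hpi u
  · exact hpi v

/-! ### The Cayley transform of a vector field -/

section Cayley

open Topology

variable {E : Type*} [NormedAddCommGroup E] [NormedSpace ℝ E]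

/-- The derivative of `m` is characterised by a relation, not by the inverse of 1 − A/2 with A =
DX(m): in this form the antisymmetry of A applies directly. -/
theorem fderiv_cayley {X : E → E} (hX : ContDiff ℝ ∞ X) {S : Set E} (hS : IsOpen S)
    {Γ m : E → E} (hm : ContDiffOn ℝ ∞ m S)
    (h : ∀ a ∈ S, m a - (1 / 2 : ℝ) • X (m a) = a ∧ Γ a = m a + (1 / 2 : ℝ) • X (m a))
    {a : E} (ha : a ∈ S) :
    (∀ v, fderiv ℝ m a v - (1 / 2 : ℝ) • fderiv ℝ X (m a) (fderiv ℝ m a v) = v) ∧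
    HasFDerivAt Γ (fderiv ℝ m a + (1 / 2 : ℝ) • (fderiv ℝ X (m a) ∘L fderiv ℝ m a)) a := by
  have h1 : HasFDerivAt m (fderiv ℝ m a) a :=
    ((hm.contDiffAt (hS.mem_nhds ha)).differentiableAt (by simp)).hasFDerivAt
  have h2 : HasFDerivAt (fun a => X (m a)) (fderiv ℝ X (m a) ∘L fderiv ℝ m a) a :=
    ((hX.differentiable (by simp)) (m a)).hasFDerivAt.comp a h1
  have h3 := h2.const_smul (1 / 2 : ℝ)
  refine ⟨fun v => ?_, ?_⟩
  · have h4 : HasFDerivAt (fun a => m a - (1 / 2 : ℝ) • X (m a)) (ContinuousLinearMap.id ℝ E) a :=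
      (hasFDerivAt_id a).congr_of_eventuallyEq
        (Filter.eventuallyEq_of_mem (hS.mem_nhds ha) fun b hb => (h b hb).1)
    exact DFunLike.congr_fun ((h1.sub h3).unique h4) v
  · exact (h1.add h3).congr_of_eventuallyEq
      (Filter.eventuallyEq_of_mem (hS.mem_nhds ha) fun b hb => (h b hb).2)

variable [CompleteSpace E]

/-- A continuous linear map close to the identity, as an equivalence. -/
theorem exists_equiv_id_add {A : E →L[ℝ] E} (hA : ‖A‖ < 1) :
    ∃ e : E ≃L[ℝ] E, (e : E →L[ℝ] E) = ContinuousLinearMap.id ℝ E + A := by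
  refine ⟨ContinuousLinearEquiv.ofUnit (Units.oneSub (-A) (by rwa [norm_neg])), ?_⟩
  ext v
  simp [ContinuousLinearEquiv.ofUnit]

/-- The inverse function theorem gives smoothness of the inverse at the image of 0 only. Restricting
the source to ‖DY‖ < 1, where 1 + DY is invertible, gives it on the whole target. -/
theorem exists_localHomeo {Y : E → E} (hY : ContDiff ℝ ∞ Y) (h1 : fderiv ℝ Y 0 = 0) :
    ∃ e : OpenPartialHomeomorph E E, 0 ∈ e.source ∧ (∀ u, e u = u + Y u) ∧
      ContDiffOn ℝ ∞ e.symm e.target := by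
  have hf : ContDiff ℝ ∞ fun u => u + Y u := contDiff_id.add hY
  have hd (u : E) : HasFDerivAt (fun u => u + Y u)
      (ContinuousLinearMap.id ℝ E + fderiv ℝ Y u) u :=
    (hasFDerivAt_id u).add ((hY.differentiable (by simp)) u).hasFDerivAt
  have hd0 : HasFDerivAt (fun u => u + Y u)
      (ContinuousLinearEquiv.refl ℝ E : E →L[ℝ] E) 0 := by
    refine (hd 0).congr_fderiv ?_
    rw [h1, add_zero]; rfl
  let e := hf.contDiffAt.toOpenPartialHomeomorph _ hd0 (by simp)
  have hcont : Continuous fun u => ‖fderiv ℝ Y u‖ := (hY.continuous_fderiv (by simp)).norm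
  have hopen : IsOpen {u | ‖fderiv ℝ Y u‖ < 1} := isOpen_lt hcont continuous_const
  refine ⟨e.restrOpen _ hopen, ⟨?_, ?_⟩, fun u => rfl, fun y hy => ?_⟩
  · exact hf.contDiffAt.mem_toOpenPartialHomeomorph_source hd0 (by simp)
  · simp [h1]
  · have hx := (e.restrOpen _ hopen).map_target hy
    obtain ⟨e', he'⟩ := exists_equiv_id_add hx.2
    refine ((e.restrOpen _ hopen).contDiffAt_symm (f₀' := e') hy ?_ ?_).contDiffWithinAt
    · rw [he']; exact hd _
    · exact hf.contDiffAt

/-- Γ is the composition of (id − X/2)⁻¹, which produces the midpoint `m`, with id + X/2. The set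
`V` serves to keep the midpoint as small as the later estimates require. -/
theorem exists_cayley {X : E → E} (hX : ContDiff ℝ ∞ X) (h0 : X 0 = 0)
    (h1 : fderiv ℝ X 0 = 0) {V : Set E} (hV : V ∈ 𝓝 0) :
    ∃ (Γ : OpenPartialHomeomorph E E) (m : E → E), 0 ∈ Γ.source ∧
      ContDiffOn ℝ ∞ Γ Γ.source ∧ ContDiffOn ℝ ∞ Γ.symm Γ.target ∧
      ContDiffOn ℝ ∞ m Γ.source ∧ ∀ a ∈ Γ.source, m a ∈ V ∧
        m a - (1 / 2 : ℝ) • X (m a) = a ∧ Γ a = m a + (1 / 2 : ℝ) • X (m a) := by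
  have hd0 : DifferentiableAt ℝ X 0 := (hX.differentiable (by simp)) 0
  obtain ⟨e, he0, he, hes⟩ := exists_localHomeo (Y := fun u => (-(1 / 2) : ℝ) • X u)
    (hX.const_smul _) (by rw [fderiv_fun_const_smul hd0, h1, smul_zero])
  obtain ⟨f, hf0, hf, hfs⟩ := exists_localHomeo (Y := fun u => (1 / 2 : ℝ) • X u)
    (hX.const_smul _) (by rw [fderiv_fun_const_smul hd0, h1, smul_zero])
  obtain ⟨U, hUV, hU, h0U⟩ := mem_nhds_iff.1 hV
  let e' := e.restrOpen U hU
  have hes' : ContDiffOn ℝ ∞ e'.symm e'.target := hes.mono fun y hy => hy.1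
  have hee : ContDiff ℝ ∞ e' := by
    have : (e' : E → E) = fun u => u + (-(1 / 2) : ℝ) • X u := funext he
    rw [this]; exact contDiff_id.add (hX.const_smul _)
  have hff : ContDiff ℝ ∞ f := by
    have : (f : E → E) = fun u => u + (1 / 2 : ℝ) • X u := funext hf
    rw [this]; exact contDiff_id.add (hX.const_smul _)
  have h00 : e' 0 = 0 := by
    refine (he 0).trans ?_
    simp [h0]
  have h0e : (0 : E) ∈ e'.source := ⟨he0, h0U⟩
  have h0s : e'.symm 0 = 0 := by
    conv_lhs => rw [← h00]
    exact e'.left_inv h0e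
  refine ⟨e'.symm.trans f, e'.symm, ⟨?_, ?_⟩, ?_, ?_, ?_, fun a ha => ?_⟩
  · rw [← h00]; exact e'.map_source h0e
  · change e'.symm 0 ∈ f.source
    rwa [h0s]
  · exact hff.comp_contDiffOn (hes'.mono fun a ha => ha.1)
  · exact hee.comp_contDiffOn (hfs.mono fun a ha => ha.1)
  · exact hes'.mono fun a ha => ha.1
  · have hm := e'.map_target ha.1
    have hi : e' (e'.symm a) = a := e'.right_inv ha.1
    refine ⟨hUV hm.2, ?_, hf _⟩
    conv_rhs => rw [← hi]
    refine Eq.trans ?_ (he _).symm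
    rw [neg_smul, sub_eq_add_neg]

end Cayley

/-! ### Hamiltonian vector fields and the Cayley transform -/

/-- The differential of a Hamiltonian vector field is antisymmetric for the symplectic form. -/
theorem sympl_fderiv_antisymm {H : L1 → ℝ} {X : L1 → L1}
    (hH : ∀ u, HasFDerivAt H (sympl.flip (X u)) u) (hX : Differentiable ℝ X) (u v w : L1) :
    sympl (fderiv ℝ X u v) w = -sympl v (fderiv ℝ X u w) := by
  have h2 : HasFDerivAt (fun u => sympl.flip (X u)) (sympl.flip ∘L fderiv ℝ X u) u :=
    sympl.flip.hasFDerivAt.comp u (hX u).hasFDerivAt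
  have := second_derivative_symmetric hH h2 v w
  simp only [ContinuousLinearMap.comp_apply, ContinuousLinearMap.flip_apply] at this
  rw [sympl_antisymm, this]

/-- In both expansions the terms linear in `A` cancel by antisymmetry, and the remaining ones are
even in `A`. -/
theorem sympl_cayley {A : L1 →L[ℝ] L1} (hA : ∀ v w, sympl (A v) w = -sympl v (A w)) (p q : L1) :
    sympl (p + (1 / 2 : ℝ) • A p) (q + (1 / 2 : ℝ) • A q) =
      sympl (p - (1 / 2 : ℝ) • A p) (q - (1 / 2 : ℝ) • A q) := by
  simp only [map_add, map_sub, map_smul, add_apply,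
    sub_apply, smul_apply, hA, smul_eq_mul]
  ring

theorem exists_id_add_half {E : Type*} [NormedAddCommGroup E] [NormedSpace ℝ E] [CompleteSpace E]
    {A : E →L[ℝ] E} (hA : ‖A‖ < 1) (w : E) :
    ∃ y, y + (1 / 2 : ℝ) • A y = w := by
  have h2 : ‖(1 / 2 : ℝ) • A‖ < 1 := by
    rw [norm_smul]; norm_num; linarith [norm_nonneg A]
  obtain ⟨e, he⟩ := exists_equiv_id_add h2
  refine ⟨e.symm w, ?_⟩
  have := DFunLike.congr_fun he (e.symm w)
  simpa using this.symm

theorem norm_le_of_id_add_half {E : Type*} [NormedAddCommGroup E] [NormedSpace ℝ E]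
    {A : E →L[ℝ] E} (hA : ‖A‖ < 1) {y w : E} (h : y + (1 / 2 : ℝ) • A y = w) :
    ‖y‖ ≤ 2 * ‖w‖ := by
  have h1 : ‖(1 / 2 : ℝ) • A y‖ ≤ 1 / 2 * ‖y‖ := by
    rw [norm_smul]
    have := A.le_of_opNorm_le hA.le y
    norm_num; linarith
  have h2 : y = w - (1 / 2 : ℝ) • A y := by rw [← h, add_sub_cancel_right]
  have h3 := norm_sub_le w ((1 / 2 : ℝ) • A y)
  rw [← h2] at h3
  linarith

/-! ### Weighted quadratic forms -/

theorem norm_mono {n : ℕ} (u : L1) (k : Fin n → Z2) : ‖mono u k‖ = ∏ i, ‖u (k i)‖ := by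
  rw [mono, norm_prod]
  exact Finset.prod_congr rfl fun i _ => norm_altL_apply _ _ _

/-- The weight `W`, multiplied by `i`, acting on `ℓ¹`. -/
def rotate (W : Z2 → ℝ) (C : ℝ) (hW : ∀ k, |W k| ≤ C) (u : L1) : L1 :=
  mulWeight (fun k => Complex.I * W k) C (fun k => by simpa using hW k) u

/-- Putting iWu into a slot multiplies the monomial by iW or −iW according to conjugation, so the
bracket with a weighted quadratic form is diagonal on monomials. For W = |k|² the multiplier is i
times the resonance function. -/
theorem hasSum_rotate_polyField {n : ℕ} {c : (Fin n → Z2) → ℂ} (hc : ∀ k, ‖c k‖ ≤ 1)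
    {W : Z2 → ℝ} {C : ℝ} (hW : ∀ k, |W k| ≤ C) (u : L1) :
    HasSum (fun k : Fin n → Z2 => (Complex.I * (∑ i : Fin n, (-1 : ℝ) ^ ((i : ℕ) + 1) * W (k i) :
      ℝ) * (mono u k * neutralCoeff c k)).re) (-sympl (rotate W C hW u) (polyField c hc u)) := by
  rw [sympl_polyField, ← Finset.sum_neg_distrib]
  have h (i : Fin n) := (Complex.hasSum_re (hasSum_tupleLift (norm_neutralCoeff_le hc)
    (Function.update (fun j : Fin n => altL j u) i (altL i (rotate W C hW u))))).neg
  refine (hasSum_sum (s := Finset.univ) fun i _ => h i).congr_fun ?_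
  intro k
  have h2 (i : Fin n) : ∏ j, (Function.update (fun j : Fin n => altL j u) i
      (altL i (rotate W C hW u)) j) (k j) =
      -((-1 : ℝ) ^ ((i : ℕ) + 1) * W (k i) : ℝ) * Complex.I * mono u k := by
    rw [mono, Fintype.prod_eq_mul_prod_subtype_ne _ i, Fintype.prod_eq_mul_prod_subtype_ne _ i,
      ← mul_assoc]
    congr 1
    · rw [Function.update_self, altL_apply, altL_apply]
      by_cases ho : Odd ((i : ℕ) + 1)
      · simp only [if_pos ho, ho.neg_one_pow, rotate, mulWeight_apply]
        push_cast; ring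
      · simp only [if_neg ho, (Nat.not_odd_iff_even.1 ho).neg_one_pow, rotate, mulWeight_apply,
          map_mul, Complex.conj_I, Complex.conj_ofReal]
        push_cast; ring
    · refine Finset.prod_congr rfl fun j _ => ?_
      rw [Function.update_of_ne j.2]
  have h3 (r : ℝ) (z : ℂ) : (Complex.I * r * z).re = r * (Complex.I * z).re := by
    rw [mul_comm Complex.I, mul_assoc, Complex.re_ofReal_mul]
  rw [h3, Finset.sum_mul]
  refine Finset.sum_congr rfl fun i _ => ?_
  rw [h2, ← h3, ← Complex.neg_re, smul_eq_mul]
  congr 1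
  ring

/-- The weighted quadratic form `∑ₖ Wₖ |uₖ|²`. -/
def wq (W : Z2 → ℝ) (u : L1) : ℝ := ∑' k, W k * ‖u k‖ ^ 2

theorem summable_wq {W : Z2 → ℝ} {C : ℝ} (hW : ∀ k, |W k| ≤ C) (u : L1) :
    Summable fun k => W k * ‖u k‖ ^ 2 := by
  refine Summable.of_norm_bounded ((summable_norm u).mul_left (C * ‖u‖)) fun k => ?_
  rw [Real.norm_eq_abs, abs_mul, abs_of_nonneg (sq_nonneg ‖u k‖), sq, mul_assoc]
  have h0 : 0 ≤ C := (abs_nonneg _).trans (hW k)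
  gcongr
  · exact hW k
  · exact norm_apply_le u k

/-- Polarization: the terms quadratic in `x` cancel in the symmetric difference, so the midpoint
rule is exact for quadratic forms. -/
theorem wq_cayley {W : Z2 → ℝ} {C : ℝ} (hW : ∀ k, |W k| ≤ C) (m x : L1) :
    wq W (m + (1 / 2 : ℝ) • x) - wq W (m - (1 / 2 : ℝ) • x) =
      -(2 * sympl (rotate W C hW m) x) := by
  rw [wq, wq, ← (summable_wq hW _).tsum_sub (summable_wq hW _), sympl_apply, ← neg_mul,
    ← Complex.imCLM_apply, Complex.imCLM.map_tsum (summable_pairing _ _).of_norm,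
    ← tsum_mul_left]
  refine tsum_congr fun k => ?_
  simp only [lp.coeFn_add, lp.coeFn_sub, lp.coeFn_smul, Pi.add_apply, Pi.sub_apply,
    Pi.smul_apply, rotate, mulWeight_apply, Complex.sq_norm, Complex.normSq_apply,
    Complex.imCLM_apply]
  simp
  ring

/-- The parallelogram identity, with the nonnegative term in `x` dropped. -/
theorem wq_midpoint_le {W : Z2 → ℝ} {C : ℝ} (hW : ∀ k, |W k| ≤ C) (h0 : ∀ k, 0 ≤ W k)
    (m x : L1) :
    2 * wq W m ≤ wq W (m + (1 / 2 : ℝ) • x) + wq W (m - (1 / 2 : ℝ) • x) := by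
  rw [wq, wq, wq, ← (summable_wq hW _).tsum_add (summable_wq hW _), ← tsum_mul_left]
  refine ((summable_wq hW m).mul_left 2).tsum_le_tsum (fun k => ?_)
    ((summable_wq hW _).add (summable_wq hW _))
  rw [← mul_add, mul_left_comm]
  refine mul_le_mul_of_nonneg_left ?_ (h0 k)
  simp only [lp.coeFn_add, lp.coeFn_sub, lp.coeFn_smul, Pi.add_apply, Pi.sub_apply,
    Pi.smul_apply, Complex.sq_norm, Complex.normSq_apply]
  simp
  nlinarith [sq_nonneg (x k).re, sq_nonneg (x k).im]

/-! ### Estimates for subadditive weights -/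

/-- A weight with the triangle inequality along tuples of zero momentum. -/
def Subadd (n : ℕ) (w : Z2 → ℝ) : Prop :=
  (∀ k, 0 ≤ w k) ∧ ∀ k : Fin n → Z2, Neutral k → ∀ i,
    w (k i) ≤ ∑ j ∈ Finset.univ.erase i, w (k j)

open Classical in
/-- The indicator of the neutral tuples. -/
def neutralInd {n : ℕ} (k : Fin n → Z2) : ℝ := if Neutral k then 1 else 0

/-- Neutrality determines the mode in slot `j` from the others, which range freely; the sum
therefore factorizes. -/
theorem hasSum_neutral_erase {n : ℕ} (j : Fin n) {f : Fin n → Z2 → ℝ}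
    (hf : ∀ l, Summable fun k => ‖f l k‖) :
    HasSum (fun k : Fin n → Z2 => neutralInd k * ∏ l ∈ Finset.univ.erase j, f l (k l))
      (∏ l ∈ Finset.univ.erase j, ∑' κ, f l κ) := by
  have hp (g : Fin n → ℝ) : ∏ l ∈ Finset.univ.erase j, g l = ∏ l : {l // l ≠ j}, g l :=
    Finset.prod_subtype _ (by simp) g
  have h1 := hasSum_prod (f := fun (l : {l // l ≠ j}) κ => f l κ) fun l => hf l
  rw [hp]
  simp only [hp]
  have hinj : Function.Injective fun k : {l // l ≠ j} → Z2 =>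
      (Equiv.funSplitAt j Z2).symm (completion j k, k) := fun k k' h => by
    simpa using congrArg Prod.snd ((Equiv.funSplitAt j Z2).symm.injective h)
  refine (hinj.hasSum_iff ?_).1 ?_
  · intro k hk
    have : ¬ Neutral k := fun hn => hk ⟨(Equiv.funSplitAt j Z2 k).2, by
      have := (neutral_iff j (k j) (Equiv.funSplitAt j Z2 k).2).1 (by
        convert hn
        exact (Equiv.funSplitAt j Z2).symm_apply_apply k)
      simp only [← this]
      exact (Equiv.funSplitAt j Z2).symm_apply_apply k⟩
    rw [neutralInd, if_neg this, zero_mul]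
  · refine h1.congr_fun fun k => ?_
    rw [Function.comp_apply, neutralInd, if_pos ((neutral_iff j _ k).2 rfl), one_mul]
    refine Finset.prod_congr rfl fun l _ => ?_
    simp [Equiv.funSplitAt, Equiv.piSplitAt, l.2]

/-- One of the two factors w(kᵢ) is moved to another slot j by subadditivity. Then
w(kᵢ)w(kⱼ)‖u(kᵢ)‖‖u(kⱼ)‖ is split by the arithmetic-geometric mean inequality; in each half one slot
carries no factor and is summed away by neutrality. The bound contains no size of `w` beyond the
quadratic form. -/
theorem summable_subadd {n : ℕ} {w : Z2 → ℝ} (hw : Subadd n w) {u : L1}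
    (hu : Summable fun k => w k ^ 2 * ‖u k‖ ^ 2) (i : Fin n) :
    (Summable fun k : Fin n → Z2 => neutralInd k * (w (k i) ^ 2 * ∏ l, ‖u (k l)‖)) ∧
    ∑' k : Fin n → Z2, neutralInd k * (w (k i) ^ 2 * ∏ l, ‖u (k l)‖) ≤
      (n - 1 : ℕ) * (wq (fun k => w k ^ 2) u * ‖u‖ ^ (n - 2)) := by
  let f (i l : Fin n) (k : Z2) : ℝ := if l = i then w k ^ 2 * ‖u k‖ ^ 2 else ‖u k‖
  have hf (i l : Fin n) : Summable fun k => ‖f i l k‖ := by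
    by_cases h : l = i
    · refine hu.congr fun k => ?_
      simp only [f, if_pos h, Real.norm_eq_abs]
      rw [abs_of_nonneg (by positivity)]
    · simpa [f, h] using summable_norm u
  have hprod (i j : Fin n) (hij : i ≠ j) :
      ∏ l ∈ Finset.univ.erase j, ∑' κ, f i l κ = wq (fun k => w k ^ 2) u * ‖u‖ ^ (n - 2) := by
    have hi : i ∈ Finset.univ.erase j := by simp [hij]
    rw [← Finset.mul_prod_erase _ _ hi]
    congr 1
    · simp [f, wq]
    · rw [Finset.prod_congr rfl (g := fun _ => ‖u‖), Finset.prod_const,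
        Finset.card_erase_of_mem hi, Finset.card_erase_of_mem (Finset.mem_univ _)]
      · simp; rfl
      · intro l hl
        simp [f, Finset.ne_of_mem_erase hl, norm_eq_tsum]
  -- The two halves of the arithmetic-geometric mean: the weight sits in slot `i` with slot `j`
  -- free, and conversely.
  have hH (j : Fin n) (hij : i ≠ j) :=
    (((hasSum_neutral_erase j (hf i)).add (hasSum_neutral_erase i (hf j))).mul_left (1 / 2))
  have hS := hasSum_sum (s := Finset.univ.erase i) fun j hj => hH j (Finset.ne_of_mem_erase hj).symm
  have hle (k : Fin n → Z2) : neutralInd k * (w (k i) ^ 2 * ∏ l, ‖u (k l)‖) ≤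
      ∑ j ∈ Finset.univ.erase i, 1 / 2 *
        (neutralInd k * ∏ l ∈ Finset.univ.erase j, f i l (k l) +
          neutralInd k * ∏ l ∈ Finset.univ.erase i, f j l (k l)) := by
    by_cases hk : Neutral k
    swap
    · simp [neutralInd, hk]
    simp only [neutralInd, if_pos hk, one_mul]
    calc w (k i) ^ 2 * ∏ l, ‖u (k l)‖
        ≤ w (k i) * (∑ j ∈ Finset.univ.erase i, w (k j)) * ∏ l, ‖u (k l)‖ := by
          rw [sq]
          gcongr
          · exact hw.1 _
          · exact hw.2 k hk i
      _ = ∑ j ∈ Finset.univ.erase i, w (k i) * w (k j) * ∏ l, ‖u (k l)‖ := by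
          rw [Finset.mul_sum, Finset.sum_mul]
      _ ≤ _ := Finset.sum_le_sum fun j hj => ?_
    have hji : j ≠ i := Finset.ne_of_mem_erase hj
    have e1 : ∏ l, ‖u (k l)‖ = ‖u (k i)‖ * (‖u (k j)‖ *
        ∏ l ∈ (Finset.univ.erase i).erase j, ‖u (k l)‖) := by
      rw [Finset.mul_prod_erase _ (fun l => ‖u (k l)‖) hj,
        Finset.mul_prod_erase _ (fun l => ‖u (k l)‖) (Finset.mem_univ i)]
    have e2 (i j : Fin n) (hij : i ≠ j) : ∏ l ∈ Finset.univ.erase j, f i l (k l) =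
        w (k i) ^ 2 * ‖u (k i)‖ ^ 2 * ∏ l ∈ (Finset.univ.erase j).erase i, ‖u (k l)‖ := by
      rw [← Finset.mul_prod_erase _ _ (Finset.mem_erase.2 ⟨hij, Finset.mem_univ i⟩)]
      congr 1
      · simp [f]
      · refine Finset.prod_congr rfl fun l hl => ?_
        simp [f, Finset.ne_of_mem_erase hl]
    rw [e1, e2 i j hji.symm, e2 j i hji, Finset.erase_right_comm]
    have hB : 0 ≤ ∏ l ∈ (Finset.univ.erase j).erase i, ‖u (k l)‖ :=
      Finset.prod_nonneg fun _ _ => norm_nonneg _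
    nlinarith [mul_nonneg (sq_nonneg (w (k i) * ‖u (k i)‖ - w (k j) * ‖u (k j)‖)) hB]
  have h0 (k : Fin n → Z2) : 0 ≤ neutralInd k * (w (k i) ^ 2 * ∏ l, ‖u (k l)‖) := by
    refine mul_nonneg ?_ (mul_nonneg (sq_nonneg _) (Finset.prod_nonneg fun _ _ => norm_nonneg _))
    unfold neutralInd; split_ifs <;> simp
  have hs := hS.summable.of_nonneg_of_le h0 hle
  refine ⟨hs, (hasSum_le hle hs.hasSum hS).trans_eq ?_⟩
  rw [Finset.sum_congr rfl fun j hj => by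
    rw [hprod i j (Finset.ne_of_mem_erase hj).symm, hprod j i (Finset.ne_of_mem_erase hj)]]
  rw [Finset.sum_const, Finset.card_erase_of_mem (Finset.mem_univ i), Finset.card_univ,
    Fintype.card_fin, nsmul_eq_mul]
  ring

/-! ### Conservation of the kinetic energy along the Cayley transform -/

/-- A mode as a complex number. -/
def toC : Z2 →+ ℂ where
  toFun k := k 0 + k 1 * Complex.I
  map_zero' := by simp
  map_add' k l := by simp; ring

theorem norm_toC_sq (k : Z2) : ‖toC k‖ ^ 2 = sqLen k := by
  have h : toC k = ((k 0 : ℝ) : ℂ) + ((k 1 : ℝ) : ℂ) * Complex.I := by simp [toC]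
  rw [h, Complex.sq_norm, Complex.normSq_add_mul_I, sqLen, Fin.sum_univ_two]
  push_cast; ring

theorem norm_toC_neg_one_pow (i : ℕ) (k : Z2) : ‖toC ((-1 : ℤ) ^ i • k)‖ = ‖toC k‖ := by
  rcases neg_one_pow_eq_or ℤ i with h | h <;> simp [h]

theorem subadd_norm_toC (n : ℕ) : Subadd n fun k => ‖toC k‖ := by
  refine ⟨fun _ => norm_nonneg _, fun k hk i => ?_⟩
  rw [Neutral, ← Finset.add_sum_erase _ _ (Finset.mem_univ i)] at hk
  change ‖toC (k i)‖ ≤ ∑ j ∈ Finset.univ.erase i, ‖toC (k j)‖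
  rw [← norm_toC_neg_one_pow ((i : ℕ) + 1), eq_neg_of_add_eq_zero_left hk, map_neg, norm_neg,
    map_sum]
  refine norm_sum_le_of_le _ fun j _ => ?_
  rw [norm_toC_neg_one_pow]

/-- If some other mode reaches the height N, its truncated weight alone suffices; otherwise no term
on the right is truncated. -/
theorem Subadd.min {n : ℕ} {w : Z2 → ℝ} (hw : Subadd n w) {N : ℝ} (hN : 0 ≤ N) :
    Subadd n fun k => min (w k) N := by
  have h0 (k : Z2) : 0 ≤ Min.min (w k) N := le_min (hw.1 k) hN
  refine ⟨h0, fun k hk i => ?_⟩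
  by_cases h : ∃ j ∈ Finset.univ.erase i, N ≤ w (k j)
  · obtain ⟨j, hj, hjN⟩ := h
    calc Min.min (w (k i)) N ≤ N := min_le_right _ _
      _ = Min.min (w (k j)) N := (min_eq_right hjN).symm
      _ ≤ _ := Finset.single_le_sum (f := fun j => Min.min (w (k j)) N) (fun j _ => h0 _) hj
  · push Not at h
    rw [Finset.sum_congr rfl fun j hj => min_eq_left (h j hj).le]
    exact (min_le_left _ _).trans (hw.2 k hk i)

/-- The truncation of `|k|²` at height `N²`. -/
def truncWeight (N : ℕ) (k : Z2) : ℝ := min ‖toC k‖ N ^ 2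

theorem abs_truncWeight_le (N : ℕ) (k : Z2) : |truncWeight N k| ≤ (N : ℝ) ^ 2 := by
  rw [truncWeight, abs_of_nonneg (sq_nonneg _)]
  exact pow_le_pow_left₀ (by positivity) (min_le_right _ _) 2

theorem truncWeight_nonneg (N : ℕ) (k : Z2) : 0 ≤ truncWeight N k := sq_nonneg _

theorem truncWeight_le (N : ℕ) (k : Z2) : truncWeight N k ≤ sqLen k := by
  rw [← norm_toC_sq]
  exact pow_le_pow_left₀ (by positivity) (min_le_left _ _) 2

theorem truncWeight_eventually (k : Z2) :
    ∀ᶠ N in Filter.atTop, truncWeight N k = sqLen k := by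
  obtain ⟨M, hM⟩ := exists_nat_ge ‖toC k‖
  filter_upwards [Filter.eventually_ge_atTop M] with N hN
  rw [truncWeight, min_eq_left (hM.trans (by exact_mod_cast hN)), norm_toC_sq]

theorem wq_truncWeight_le {u : L1} (hu : FiniteEnergy u) (N : ℕ) :
    wq (truncWeight N) u ≤ 2 * quadHam u := by
  rw [quadHam, ← mul_assoc]; norm_num
  exact (summable_wq (abs_truncWeight_le N) u).tsum_le_tsum (fun k =>
    mul_le_mul_of_nonneg_right (truncWeight_le N k) (sq_nonneg _)) hu

theorem finiteEnergy_of_bdd {u : L1} {C : ℝ} (h : ∀ N, wq (truncWeight N) u ≤ C) :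
    FiniteEnergy u := by
  refine summable_of_sum_le (c := C) (fun k => ?_) fun s => ?_
  · rw [← norm_toC_sq]; positivity
  · have : ∀ᶠ N in Filter.atTop, ∀ k ∈ s, truncWeight N k = sqLen k :=
      (Filter.eventually_all_finset s).2 fun k _ => truncWeight_eventually k
    obtain ⟨N, hN⟩ := this.exists
    rw [Finset.sum_congr rfl fun k hk => by rw [← hN k hk]]
    exact ((summable_wq (abs_truncWeight_le N) u).sum_le_tsum s fun k _ =>
      mul_nonneg (truncWeight_nonneg N k) (sq_nonneg _)).trans (h N)

theorem tendsto_wq_truncWeight {u : L1} (hu : FiniteEnergy u) :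
    Filter.Tendsto (fun N => wq (truncWeight N) u) Filter.atTop (nhds (2 * quadHam u)) := by
  have h2 : 2 * quadHam u = ∑' k, (sqLen k : ℝ) * ‖u k‖ ^ 2 := by rw [quadHam]; ring
  rw [h2]
  refine tendsto_tsum_of_dominated_convergence hu (fun k => ?_) (Filter.Eventually.of_forall
    fun N k => ?_)
  · refine tendsto_const_nhds.congr' ?_
    filter_upwards [truncWeight_eventually k] with N hN
    rw [hN]
  · rw [Real.norm_eq_abs, abs_of_nonneg (mul_nonneg (truncWeight_nonneg N k) (sq_nonneg _))]
    exact mul_le_mul_of_nonneg_right (truncWeight_le N k) (sq_nonneg _)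

theorem norm_energy_term_le {n : ℕ} {c : (Fin n → Z2) → ℂ} (hc : ∀ k, ‖c k‖ ≤ 1)
    {w W : Z2 → ℝ} (hW : ∀ k, |W k| ≤ w k ^ 2) (u : L1) (k : Fin n → Z2) :
    ‖(Complex.I * (∑ i : Fin n, (-1 : ℝ) ^ ((i : ℕ) + 1) * W (k i) : ℝ) *
      (mono u k * neutralCoeff c k)).re‖ ≤
      ∑ i : Fin n, neutralInd k * (w (k i) ^ 2 * ∏ l, ‖u (k l)‖) := by
  refine (Complex.abs_re_le_norm _).trans ?_
  have h1 : |∑ i : Fin n, (-1 : ℝ) ^ ((i : ℕ) + 1) * W (k i)| ≤ ∑ i : Fin n, w (k i) ^ 2 :=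
    (Finset.abs_sum_le_sum_abs _ _).trans <| Finset.sum_le_sum fun i _ => by
      rw [abs_mul, abs_pow, abs_neg, abs_one, one_pow, one_mul]; exact hW _
  have h2 : ‖neutralCoeff c k‖ ≤ neutralInd k := by
    unfold neutralCoeff neutralInd
    split_ifs
    · exact hc k
    · simp
  rw [norm_mul, norm_mul, norm_mul, Complex.norm_I, one_mul, Complex.norm_real, norm_mono,
    Real.norm_eq_abs, ← Finset.mul_sum, ← Finset.sum_mul]
  have h3 : 0 ≤ ∏ l, ‖u (k l)‖ := Finset.prod_nonneg fun _ _ => norm_nonneg _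
  calc _ ≤ (∑ i : Fin n, w (k i) ^ 2) * ((∏ l, ‖u (k l)‖) * neutralInd k) := by gcongr
    _ = _ := by ring

theorem summable_energy {n : ℕ} {w : Z2 → ℝ} (hw : Subadd n w) {u : L1}
    (hu : Summable fun k => w k ^ 2 * ‖u k‖ ^ 2) :
    (Summable fun k : Fin n → Z2 => ∑ i : Fin n, neutralInd k * (w (k i) ^ 2 * ∏ l, ‖u (k l)‖)) ∧
    ∑' k : Fin n → Z2, ∑ i : Fin n, neutralInd k * (w (k i) ^ 2 * ∏ l, ‖u (k l)‖) ≤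
      n * ((n - 1 : ℕ) * (wq (fun k => w k ^ 2) u * ‖u‖ ^ (n - 2))) := by
  refine ⟨summable_sum fun i _ => (summable_subadd hw hu i).1, ?_⟩
  rw [Summable.tsum_finsetSum fun i _ => (summable_subadd hw hu i).1]
  refine (Finset.sum_le_sum fun i _ => (summable_subadd hw hu i).2).trans_eq ?_
  simp

/-- The difference is at most the form at the midpoint, by the smallness of `m`, and this is at most
half the sum of the end values. The constant does not depend on `N`. -/
theorem wq_trunc_cayley_le {n : ℕ} {c : (Fin n → Z2) → ℂ} (hc : ∀ k, ‖c k‖ ≤ 1) {m : L1}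
    (hm : n * (n - 1 : ℕ) * ‖m‖ ^ (n - 2) ≤ 1 / 2) (N : ℕ) :
    |wq (truncWeight N) (m + (1 / 2 : ℝ) • polyField c hc m) -
      wq (truncWeight N) (m - (1 / 2 : ℝ) • polyField c hc m)| ≤
    1 / 2 * (wq (truncWeight N) (m + (1 / 2 : ℝ) • polyField c hc m) +
      wq (truncWeight N) (m - (1 / 2 : ℝ) • polyField c hc m)) := by
  have hW := abs_truncWeight_le N
  have hsub : Subadd n fun k => min ‖toC k‖ N := (subadd_norm_toC n).min (by positivity)
  have h1 := wq_midpoint_le hW (truncWeight_nonneg N) m (polyField c hc m)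
  have h2 := hasSum_rotate_polyField hc hW m
  obtain ⟨h3, h4⟩ := summable_energy hsub (u := m) (summable_wq hW m)
  have h5 := tsum_of_norm_bounded h3.hasSum (norm_energy_term_le hc (W := truncWeight N)
    (fun k => (abs_of_nonneg (sq_nonneg _)).le) m)
  rw [h2.tsum_eq, norm_neg, Real.norm_eq_abs] at h5
  have h6 := h5.trans h4
  rw [wq_cayley hW, abs_neg, abs_mul, abs_two]
  have h7 : 0 ≤ wq (truncWeight N) m :=
    tsum_nonneg fun k => mul_nonneg (truncWeight_nonneg N k) (sq_nonneg _)
  have h8 : (n : ℝ) * ((n - 1 : ℕ) * (wq (truncWeight N) m * ‖m‖ ^ (n - 2))) ≤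
      1 / 2 * wq (truncWeight N) m := by
    calc _ = n * (n - 1 : ℕ) * ‖m‖ ^ (n - 2) * wq (truncWeight N) m := by ring
      _ ≤ _ := mul_le_mul_of_nonneg_right hm h7
  have h9 := h6.trans h8
  linarith

/-- From |x − y| ≤ (x + y)/2 follow x ≤ 3y and y ≤ 3x, uniformly in the truncation. -/
theorem finiteEnergy_cayley {n : ℕ} {c : (Fin n → Z2) → ℂ} (hc : ∀ k, ‖c k‖ ≤ 1) {m : L1}
    (hm : n * (n - 1 : ℕ) * ‖m‖ ^ (n - 2) ≤ 1 / 2) :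
    FiniteEnergy (m + (1 / 2 : ℝ) • polyField c hc m) ↔
      FiniteEnergy (m - (1 / 2 : ℝ) • polyField c hc m) := by
  constructor <;> intro h
  · refine finiteEnergy_of_bdd (C := 3 * (2 * quadHam (m + (1 / 2 : ℝ) • polyField c hc m)))
      fun N => ?_
    have h1 := wq_trunc_cayley_le hc hm N
    have h2 := wq_truncWeight_le h N
    rw [abs_le] at h1
    linarith
  · refine finiteEnergy_of_bdd (C := 3 * (2 * quadHam (m - (1 / 2 : ℝ) • polyField c hc m)))
      fun N => ?_
    have h1 := wq_trunc_cayley_le hc hm N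
    have h2 := wq_truncWeight_le h N
    rw [abs_le] at h1
    linarith

theorem quadHam_cayley {n : ℕ} {c : (Fin n → Z2) → ℂ} (hc : ∀ k, ‖c k‖ ≤ 1) {m : L1}
    (hm : n * (n - 1 : ℕ) * ‖m‖ ^ (n - 2) ≤ 1 / 2)
    (h : FiniteEnergy (m - (1 / 2 : ℝ) • polyField c hc m)) :
    quadHam (m + (1 / 2 : ℝ) • polyField c hc m) =
      quadHam (m - (1 / 2 : ℝ) • polyField c hc m) + ∑' k : Fin n → Z2,
        (Complex.I * (∑ i : Fin n, (-1 : ℝ) ^ ((i : ℕ) + 1) * sqLen (k i) : ℝ) *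
          (mono m k * neutralCoeff c k)).re := by
  have hp := (finiteEnergy_cayley hc hm).2 h
  -- The midpoint inherits finite energy by convexity; this supplies the dominating series for N →
  -- ∞.
  have hmE : FiniteEnergy m := by
    refine finiteEnergy_of_bdd (C := quadHam (m + (1 / 2 : ℝ) • polyField c hc m) +
      quadHam (m - (1 / 2 : ℝ) • polyField c hc m)) fun N => ?_
    have h1 := wq_midpoint_le (abs_truncWeight_le N) (truncWeight_nonneg N) m (polyField c hc m)
    have h2 := wq_truncWeight_le hp N
    have h3 := wq_truncWeight_le h N
    linarith
  have ht := (tendsto_wq_truncWeight hp).sub (tendsto_wq_truncWeight h)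
  have hlim : Filter.Tendsto (fun N : ℕ => ∑' k : Fin n → Z2,
      (Complex.I * (∑ i : Fin n, (-1 : ℝ) ^ ((i : ℕ) + 1) * truncWeight N (k i) : ℝ) *
        (mono m k * neutralCoeff c k)).re) Filter.atTop (nhds (∑' k : Fin n → Z2,
      (Complex.I * (∑ i : Fin n, (-1 : ℝ) ^ ((i : ℕ) + 1) * sqLen (k i) : ℝ) *
        (mono m k * neutralCoeff c k)).re)) := by
    have hs : Summable fun k => ‖toC k‖ ^ 2 * ‖m k‖ ^ 2 := hmE.congr fun k => by rw [norm_toC_sq]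
    have hW (N : ℕ) (κ : Z2) : |truncWeight N κ| ≤ ‖toC κ‖ ^ 2 := by
      rw [abs_of_nonneg (truncWeight_nonneg N κ), norm_toC_sq]
      exact truncWeight_le N κ
    refine tendsto_tsum_of_dominated_convergence (summable_energy (subadd_norm_toC n) hs).1
      (fun k => ?_) (Filter.Eventually.of_forall fun N k =>
        norm_energy_term_le (W := truncWeight N) hc (hW N) m k)
    · refine tendsto_const_nhds.congr' ?_
      filter_upwards [Filter.eventually_all.2 fun i : Fin n => truncWeight_eventually (k i)]
        with N hN
      simp only [hN]
  have hlim2 := (hlim.const_mul 2).congr fun N => by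
    rw [(hasSum_rotate_polyField hc (abs_truncWeight_le N) m).tsum_eq, mul_neg,
      ← wq_cayley (abs_truncWeight_le N)]
  have := tendsto_nhds_unique ht hlim2
  linarith

/-! ### The Hamiltonians of the normal form -/

/-- The resonance function `∑ᵢ (-1)ⁱ |kᵢ|²`. -/
def detuning {n : ℕ} (k : Fin n → Z2) : ℤ := ∑ i : Fin n, (-1 : ℤ) ^ ((i : ℕ) + 1) * sqLen (k i)

/-- The coefficients of the resonant part. -/
def resCoeff (n : ℕ) (k : Fin n → Z2) : ℂ := if detuning k = 0 then 1 else 0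

/-- The coefficients of the solution of the homological equation. -/
def homCoeff (n : ℕ) (k : Fin n → Z2) : ℂ :=
  if detuning k = 0 then 0 else Complex.I / (detuning k : ℂ)

theorem norm_one_le (n : ℕ) (k : Fin n → Z2) : ‖(fun _ => 1 : (Fin n → Z2) → ℂ) k‖ ≤ 1 := by simp

theorem norm_resCoeff_le (n : ℕ) (k : Fin n → Z2) : ‖resCoeff n k‖ ≤ 1 := by
  unfold resCoeff; split_ifs <;> simp

/-- A nonzero integer has absolute value at least 1, so the divisors do no harm. -/
theorem norm_homCoeff_le (n : ℕ) (k : Fin n → Z2) : ‖homCoeff n k‖ ≤ 1 := by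
  unfold homCoeff
  split_ifs with h
  · simp
  · rw [norm_div, Complex.norm_I, Complex.norm_intCast]
    refine div_le_one_of_le₀ ?_ (abs_nonneg _)
    exact_mod_cast Int.one_le_abs h

theorem monomial_eq (d : ℕ) (u : L1) (k : Fin (2 * d) → Z2) : monomial d u k = mono u k := by
  simp only [monomial, mono, altL_apply]

open Classical in
theorem tsum_zeroMomentum (d : ℕ) (u : L1) :
    ∑' k : {k : Fin (2 * d) → Z2 // ZeroMomentum d k}, monomial d u k =
      polyHam (fun _ => 1) (norm_one_le (2 * d)) u := by
  rw [← (hasSum_polyHam (norm_one_le (2 * d)) u).tsum_eq]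
  refine (tsum_subtype {k | ZeroMomentum d k} (monomial d u)).trans (tsum_congr fun k => ?_)
  rw [Set.indicator_apply, monomial_eq, neutralCoeff, mul_ite, mul_one, mul_zero]
  rfl

open Classical in
theorem resHam_eq (d : ℕ) (u : L1) :
    resHam d u = polyHam (resCoeff (2 * d)) (norm_resCoeff_le (2 * d)) u := by
  rw [← (hasSum_polyHam (norm_resCoeff_le (2 * d)) u).tsum_eq]
  refine (tsum_subtype {k | Resonant d k} (monomial d u)).trans (tsum_congr fun k => ?_)
  rw [Set.indicator_apply, monomial_eq, neutralCoeff, resCoeff, ← ite_and, mul_ite, mul_one,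
    mul_zero]
  exact if_congr Iff.rfl rfl rfl

/-- The homological equation. -/
theorem tsum_homological {n : ℕ} (u : L1) :
    ∑' k : Fin n → Z2, (Complex.I * (∑ i : Fin n, (-1 : ℝ) ^ ((i : ℕ) + 1) * sqLen (k i) : ℝ) *
      (mono u k * neutralCoeff (homCoeff n) k)).re =
    (polyHam (resCoeff n) (norm_resCoeff_le n) u).re -
      (polyHam (fun _ => 1) (norm_one_le n) u).re := by
  rw [← ((Complex.hasSum_re (hasSum_polyHam (norm_resCoeff_le n) u)).sub
    (Complex.hasSum_re (hasSum_polyHam (norm_one_le n) u))).tsum_eq]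
  refine tsum_congr fun k => ?_
  have h : (∑ i : Fin n, (-1 : ℝ) ^ ((i : ℕ) + 1) * sqLen (k i) : ℝ) = (detuning k : ℝ) := by
    simp [detuning]
  rw [h, ← Complex.sub_re]
  congr 1
  unfold neutralCoeff
  split_ifs with hk
  · unfold homCoeff resCoeff
    split_ifs with h0
    · simp
    · have : (detuning k : ℂ) ≠ 0 := by exact_mod_cast h0
      push_cast
      field_simp
      rw [Complex.I_sq]; ring
  · simp

/-! ### Reality of the Hamiltonians -/

theorem odd_rev {d : ℕ} (i : Fin (2 * d)) :
    Odd ((i.rev : ℕ) + 1) ↔ ¬ Odd ((i : ℕ) + 1) := by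
  have := i.2
  rw [Fin.val_rev]
  grind

theorem neg_one_pow_rev {d : ℕ} (i : Fin (2 * d)) :
    (-1 : ℤ) ^ ((i.rev : ℕ) + 1) = -(-1 : ℤ) ^ ((i : ℕ) + 1) := by
  by_cases h : Odd ((i : ℕ) + 1)
  · rw [h.neg_one_pow, (Nat.not_odd_iff_even.1 (mt (odd_rev i).1 (not_not.2 h))).neg_one_pow,
      neg_neg]
  · rw [((odd_rev i).2 h).neg_one_pow, (Nat.not_odd_iff_even.1 h).neg_one_pow]

/-- The reversal of a tuple. -/
def revTuple (n : ℕ) : (Fin n → Z2) ≃ (Fin n → Z2) := Equiv.arrowCongr Fin.revPerm (Equiv.refl Z2)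

theorem revTuple_apply {n : ℕ} (k : Fin n → Z2) (i : Fin n) : revTuple n k i = k i.rev := rfl

theorem mono_rev {d : ℕ} (u : L1) (k : Fin (2 * d) → Z2) :
    mono u (revTuple _ k) = conj (mono u k) := by
  rw [mono, mono, map_prod, ← Equiv.prod_comp Fin.revPerm]
  refine Finset.prod_congr rfl fun i _ => ?_
  simp only [Fin.revPerm_apply, revTuple_apply, Fin.rev_rev, altL_apply, odd_rev]
  split_ifs <;> simp_all

theorem neutral_rev {d : ℕ} (k : Fin (2 * d) → Z2) : Neutral (revTuple _ k) ↔ Neutral k := by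
  unfold Neutral
  rw [← Equiv.sum_comp Fin.revPerm]
  simp only [Fin.revPerm_apply, revTuple_apply, Fin.rev_rev, neg_one_pow_rev, neg_smul,
    Finset.sum_neg_distrib, neg_eq_zero]

theorem detuning_rev {d : ℕ} (k : Fin (2 * d) → Z2) : detuning (revTuple _ k) = -detuning k := by
  unfold detuning
  rw [← Equiv.sum_comp Fin.revPerm]
  simp only [Fin.revPerm_apply, revTuple_apply, Fin.rev_rev, neg_one_pow_rev, neg_mul,
    Finset.sum_neg_distrib]

/-- As the length is even, reversal exchanges conjugated and unconjugated slots: it conjugates each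
monomial and preserves neutrality, so the sum equals its conjugate. -/
theorem polyHam_real {d : ℕ} {c : (Fin (2 * d) → Z2) → ℂ} (hc : ∀ k, ‖c k‖ ≤ 1)
    (hr : ∀ k, c (revTuple _ k) = conj (c k)) (u : L1) :
    polyHam c hc u = ((polyHam c hc u).re : ℂ) := by
  have h1 := hasSum_polyHam hc u
  have h2 := (revTuple _).hasSum_iff.2 h1
  have h3 := (Complex.hasSum_conj'.2 h1)
  have h4 : polyHam c hc u = conj (polyHam c hc u) := by
    refine h2.unique (h3.congr_fun fun k => ?_)
    simp only [Function.comp_apply, mono_rev, map_mul, neutralCoeff]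
    by_cases hk : Neutral k
    · rw [if_pos hk, if_pos ((neutral_rev k).2 hk), hr]
    · rw [if_neg hk, if_neg (mt (neutral_rev k).1 hk), map_zero]
  exact (Complex.conj_eq_iff_re.1 h4.symm).symm

theorem resHam_real (d : ℕ) (u : L1) : resHam d u = ((polyHam (resCoeff (2 * d))
    (norm_resCoeff_le (2 * d)) u).re : ℂ) := by
  rw [resHam_eq]
  refine polyHam_real _ (fun k => ?_) u
  simp only [resCoeff, detuning_rev, neg_eq_zero]
  split_ifs <;> simp

/-! ### The multi-index form of the resonant Hamiltonian -/

section Occupation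

variable {σ : Type*}

/-- The occupation numbers of a tuple. -/
def occ {d : ℕ} (f : Fin d → σ) : σ →₀ ℕ := ∑ j, Finsupp.single (f j) 1

theorem occ_sum {d : ℕ} {M : Type*} [AddCommMonoid M] (f : Fin d → σ) (h : σ → M) :
    ((occ f).sum fun k n => n • h k) = ∑ j, h (f j) := by
  rw [occ, ← Finsupp.sum_finsetSum_index (by simp) (by simp [add_smul])]
  simp

theorem occ_prod {d : ℕ} {M : Type*} [CommMonoid M] (f : Fin d → σ) (h : σ → M) :
    ((occ f).prod fun k n => h k ^ n) = ∏ j, h (f j) := by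
  rw [occ, ← Finsupp.prod_finsetSum_index (by simp) (by simp [pow_add])]
  simp

theorem mem_support_occ {d : ℕ} (f : Fin d → σ) (j : Fin d) : f j ∈ (occ f).support := by
  classical
  have : (occ f) (f j) ≠ 0 := by
    rw [occ, Finsupp.finsetSum_apply]
    refine (Finset.sum_pos' (fun _ _ => Nat.zero_le _) ⟨j, Finset.mem_univ j, ?_⟩).ne'
    simp
  simpa using this

open MvPolynomial in
/-- The number of tuples with given occupation numbers is a multinomial coefficient. -/
theorem card_occ (d : ℕ) (α : σ →₀ ℕ) :
    Finite {f : Fin d → σ // occ f = α} ∧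
    Nat.card {f : Fin d → σ // occ f = α} =
      if (α.sum fun _ n => n) = d then α.multinomial else 0 := by
  classical
  let S := α.support
  let T := (Fintype.piFinset fun _ : Fin d => S).filter fun f => occ f = α
  have hT (f : Fin d → σ) : f ∈ T ↔ occ f = α := by
    simp only [T, Finset.mem_filter, Fintype.mem_piFinset, and_iff_right_iff_imp]
    rintro rfl j
    exact mem_support_occ f j
  let e : {f : Fin d → σ // occ f = α} ≃ T := Equiv.subtypeEquivRight fun f => (hT f).symm
  refine ⟨Finite.of_equiv _ e.symm, ?_⟩
  rw [Nat.card_congr e, Nat.card_eq_fintype_card, Fintype.card_coe]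
  let a : σ →₀ ℕ := ∑ k ∈ S, Finsupp.single k 1
  have ha (k : σ) (hk : k ∈ S) : a k = 1 := by
    simp only [a, Finsupp.finsetSum_apply, Finsupp.single_apply]
    simp [hk]
  -- The coefficient of X^α in (∑_{k ∈ S} X_k)^d is computed twice: by the multinomial theorem, and
  -- by expanding into tuples.
  have h1 := coeff_linearCombination_X_pow a α d
  have h2 : a.linearCombination ℕ (X : σ → MvPolynomial σ ℕ) = ∑ k ∈ S, X k := by
    simp [a, map_sum]
  have h3 : (α.prod fun r m => a r ^ m) = 1 :=
    Finset.prod_eq_one fun k hk => by simp only [ha k hk, one_pow]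
  have h4 : (∑ k ∈ S, (X k : MvPolynomial σ ℕ)) ^ d =
      ∑ f ∈ Fintype.piFinset fun _ : Fin d => S, MvPolynomial.monomial (occ f) 1 := by
    have := Finset.prod_univ_sum (fun _ : Fin d => S) fun _ k => (X k : MvPolynomial σ ℕ)
    rw [Finset.prod_const, Finset.card_univ, Fintype.card_fin] at this
    rw [this]
    refine Finset.sum_congr rfl fun f _ => ?_
    rw [occ, monomial_sum_one]
    rfl
  rw [h2, h3, h4, coeff_sum] at h1
  simp only [coeff_monomial, Finset.sum_boole, mul_one, Nat.cast_id] at h1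
  exact h1

end Occupation

/-- Tuples of length `2 d` as pairs of tuples of length `d`. -/
def pairTuple (d : ℕ) : (Fin (2 * d) → Z2) ≃ (Fin d → Z2) × (Fin d → Z2) :=
  (Equiv.arrowCongr ((finProdFinEquiv (m := d) (n := 2)).trans (finCongr (mul_comm d 2))).symm
    (Equiv.refl Z2)).trans <|
  { toFun := fun k => (fun j => k (j, 0), fun j => k (j, 1))
    invFun := fun p x => if x.2 = 0 then p.1 x.1 else p.2 x.1
    left_inv := fun k => by
      funext ⟨j, b⟩
      fin_cases b <;> simp
    right_inv := fun p => by simp }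

/-- For factors that depend only on the parity of the position; this one regrouping serves
monomials, momenta and resonance functions alike. -/
theorem prod_pairTuple {d : ℕ} {M : Type*} [CommMonoid M] (k : Fin (2 * d) → Z2)
    (F : ℕ → Z2 → M) (F0 F1 : Z2 → M) (h0 : ∀ j, F (2 * j) = F0) (h1 : ∀ j, F (2 * j + 1) = F1) :
    ∏ i : Fin (2 * d), F i (k i) =
      (∏ j, F0 ((pairTuple d k).1 j)) * ∏ j, F1 ((pairTuple d k).2 j) := by
  rw [← Equiv.prod_comp ((finProdFinEquiv (m := d) (n := 2)).trans (finCongr (mul_comm d 2))),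
    Fintype.prod_prod_type, ← Finset.prod_mul_distrib]
  refine Finset.prod_congr rfl fun j _ => ?_
  rw [Fin.prod_univ_two]
  refine congrArg₂ _ ?_ ?_
  · have : (((finProdFinEquiv (m := d) (n := 2)).trans (finCongr (mul_comm d 2))) (j, 0) : ℕ) =
        2 * j := by simp [finProdFinEquiv]
    rw [this, h0]; rfl
  · have : (((finProdFinEquiv (m := d) (n := 2)).trans (finCongr (mul_comm d 2))) (j, 1) : ℕ) =
        2 * j + 1 := by simp [finProdFinEquiv, add_comm]
    rw [this, h1]; rfl

theorem sum_pairTuple {d : ℕ} {M : Type*} [AddCommGroup M] (k : Fin (2 * d) → Z2) (F : Z2 → M) :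
    ∑ i : Fin (2 * d), (-1 : ℤ) ^ ((i : ℕ) + 1) • F (k i) =
      (∑ j, F ((pairTuple d k).2 j)) - ∑ j, F ((pairTuple d k).1 j) := by
  have := prod_pairTuple (M := Multiplicative M) k
    (fun i κ => Multiplicative.ofAdd ((-1 : ℤ) ^ (i + 1) • F κ))
    (fun κ => Multiplicative.ofAdd (-F κ)) (fun κ => Multiplicative.ofAdd (F κ))
    (fun j => by funext κ; simp [pow_succ]) (fun j => by funext κ; simp [pow_succ])
  have h := congrArg Multiplicative.toAdd this
  simp only [toAdd_prod, toAdd_mul, toAdd_ofAdd, Finset.sum_neg_distrib] at h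
  rw [h]; abel

theorem mono_pairTuple {d : ℕ} (u : L1) (k : Fin (2 * d) → Z2) :
    mono u k = (∏ j, u ((pairTuple d k).1 j)) * ∏ j, conj (u ((pairTuple d k).2 j)) := by
  refine prod_pairTuple k (fun i κ => altL i u κ) (fun κ => u κ) (fun κ => conj (u κ)) (fun j => ?_) fun j => ?_
  · funext κ
    rw [altL_apply, if_pos (by simp)]
  · funext κ
    rw [altL_apply, if_neg (by simp [parity_simps])]

theorem occ_sum_sub {d : ℕ} {M : Type*} [AddCommGroup M] (f g : Fin d → Z2) (F : Z2 → M) :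
    ∑ k ∈ (occ f).support ∪ (occ g).support, ((occ f k : ℤ) - (occ g k : ℤ)) • F k =
      (∑ j, F (f j)) - ∑ j, F (g j) := by
  simp only [sub_smul, Finset.sum_sub_distrib, natCast_zsmul]
  rw [← occ_sum f, ← occ_sum g,
    Finsupp.sum_of_support_subset _ Finset.subset_union_left _ (by simp),
    Finsupp.sum_of_support_subset _ Finset.subset_union_right _ (by simp)]

theorem occ_degree {σ : Type*} {d : ℕ} (f : Fin d → σ) : ((occ f).sum fun _ n => n) = d := by
  simpa using occ_sum f (fun _ => (1 : ℕ))

theorem resonantIndex_occ {d : ℕ} (k : Fin (2 * d) → Z2) :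
    ResonantIndex d (occ (pairTuple d k).1, occ (pairTuple d k).2) ↔
      Neutral k ∧ detuning k = 0 := by
  have h1 := occ_sum_sub (pairTuple d k).1 (pairTuple d k).2 id
  have h2 := occ_sum_sub (pairTuple d k).1 (pairTuple d k).2 sqLen
  have h3 := sum_pairTuple k id
  have h4 := sum_pairTuple k sqLen
  simp only [id, smul_eq_mul] at h1 h2 h3 h4
  simp only [ResonantIndex, occ_degree, true_and]
  rw [Neutral, detuning, h1, h2, h3, h4, sub_eq_zero, sub_eq_zero, sub_eq_zero, sub_eq_zero]
  exact and_congr eq_comm eq_comm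

open Classical in
-- Monomial and resonance depend only on the occupation numbers of the unconjugated and conjugated
-- slots. Summing over the fibres, each has as many elements as the product of two multinomial
-- coefficients.
theorem resHam_eq_resHamMulti (d : ℕ) (u : L1) : resHam d u = resHamMulti d u := by
  let t (q : (Z2 →₀ ℕ) × (Z2 →₀ ℕ)) : ℂ := if ResonantIndex d q then
    (q.1.prod fun k n => u k ^ n) * (q.2.prod fun k n => conj (u k) ^ n) else 0
  let A (p : (Fin d → Z2) × (Fin d → Z2)) : (Z2 →₀ ℕ) × (Z2 →₀ ℕ) := (occ p.1, occ p.2)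
  have h1 := hasSum_polyHam (norm_resCoeff_le (2 * d)) u
  have h2 : HasSum (fun p => t (A p)) (resHam d u) := by
    rw [resHam_eq, ← (pairTuple d).hasSum_iff]
    refine h1.congr_fun fun k => ?_
    simp only [Function.comp_apply, t, A, resonantIndex_occ, occ_prod, mono_pairTuple,
      neutralCoeff, resCoeff]
    split_ifs <;> simp_all
  rw [← (Equiv.sigmaFiberEquiv A).hasSum_iff] at h2
  have h3 := h2.sigma (g := fun q => (Nat.card {p // A p = q} : ℂ) * t q) fun q => ?_
  · rw [← h3.tsum_eq]
    refine (tsum_congr fun q => ?_).trans (tsum_subtype {q | ResonantIndex d q}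
      fun q => (q.1.multinomial : ℂ) * (q.2.multinomial : ℂ) *
      (q.1.prod fun k n => u k ^ n) * (q.2.prod fun k n => conj (u k) ^ n)).symm
    rw [Set.indicator_apply]
    by_cases hq : ResonantIndex d q
    · have e : {p // A p = q} ≃ {f : Fin d → Z2 // occ f = q.1} × {f : Fin d → Z2 // occ f = q.2} :=
        (Equiv.subtypeEquivRight fun p => by simp [A, Prod.ext_iff]).trans
          (Equiv.subtypeProdEquivProd (p := fun f : Fin d → Z2 => occ f = q.1)
            (q := fun f : Fin d → Z2 => occ f = q.2))
      rw [Nat.card_congr e, Nat.card_prod, (card_occ d q.1).2, (card_occ d q.2).2,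
        if_pos hq.1, if_pos hq.2.1, if_pos (show q ∈ {q | ResonantIndex d q} from hq)]
      simp only [t, if_pos hq]
      push_cast; ring
    · rw [if_neg (show ¬ q ∈ {q | ResonantIndex d q} from hq)]
      simp [t, hq]
  · have hfin : Finite {p // A p = q} := by
      have := (card_occ d q.1).1
      have := (card_occ d q.2).1
      exact Finite.of_injective
        (β := {f : Fin d → Z2 // occ f = q.1} × {f : Fin d → Z2 // occ f = q.2})
        (fun p => (⟨p.1.1, congrArg Prod.fst p.2⟩, ⟨p.1.2, congrArg Prod.snd p.2⟩))
        fun p p' h => by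
          simp only [Prod.mk.injEq, Subtype.mk.injEq] at h
          exact Subtype.ext (Prod.ext h.1 h.2)
    have := Fintype.ofFinite {p // A p = q}
    have h4 (p : {p // A p = q}) : ((fun p => t (A p)) ∘ Equiv.sigmaFiberEquiv A) ⟨q, p⟩ = t q := by
      simp only [Function.comp_apply, Equiv.sigmaFiberEquiv_apply]
      rw [p.2]
    simp only [h4]
    rw [Nat.card_eq_fintype_card, ← nsmul_eq_mul, ← Finset.card_univ, ← Finset.sum_const]
    exact hasSum_fintype _

/-! ### Averages of powers over the torus -/

open MeasureTheory

/-- The character `e^{i (K, x)}`. -/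
def char (K : Z2) (x : Fin 2 → ℝ) : ℂ := Complex.exp (Complex.I * ∑ j, (K j : ℂ) * (x j : ℂ))

theorem norm_char (K : Z2) (x : Fin 2 → ℝ) : ‖char K x‖ = 1 := by
  have : Complex.I * ∑ j, (K j : ℂ) * (x j : ℂ) = ((∑ j, (K j : ℝ) * x j : ℝ) : ℂ) * Complex.I := by
    push_cast; ring
  rw [char, this, Complex.norm_exp_ofReal_mul_I]

theorem continuous_char (K : Z2) : Continuous (char K) := by unfold char; fun_prop

theorem conj_char (K : Z2) (x : Fin 2 → ℝ) : conj (char K x) = char (-K) x := by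
  rw [char, char, ← Complex.exp_conj]
  congr 1
  simp
  ring

theorem prod_char {ι : Type*} (s : Finset ι) (K : ι → Z2) (x : Fin 2 → ℝ) :
    ∏ i ∈ s, char (K i) x = char (∑ i ∈ s, K i) x := by
  simp only [char, ← Complex.exp_sum, ← Finset.mul_sum]
  rw [Finset.sum_comm]
  simp [Finset.sum_mul]

/-- The fundamental cube of the torus. -/
def cube : Set (Fin 2 → ℝ) := Set.Icc 0 fun _ => 2 * Real.pi

instance : IsFiniteMeasure (volume.restrict cube) :=
  ⟨by rw [Measure.restrict_apply_univ]; exact isCompact_Icc.measure_lt_top⟩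

theorem integral_exp_Icc (n : ℤ) :
    ∫ y in Set.Icc 0 (2 * Real.pi), Complex.exp (Complex.I * ((n : ℂ) * (y : ℂ))) =
      if n = 0 then (2 * Real.pi : ℂ) else 0 := by
  have hpi : (0 : ℝ) ≤ 2 * Real.pi := by positivity
  rw [integral_Icc_eq_integral_Ioc, ← intervalIntegral.integral_of_le hpi]
  split_ifs with h
  · simp [h]
  · have hc : Complex.I * (n : ℂ) ≠ 0 := mul_ne_zero Complex.I_ne_zero (by exact_mod_cast h)
    simp only [← mul_assoc]
    rw [integral_exp_mul_complex hc]
    have : Complex.I * n * ((2 * Real.pi : ℝ) : ℂ) = n * (2 * Real.pi * Complex.I) := by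
      push_cast; ring
    rw [this, Complex.exp_int_mul_two_pi_mul_I]
    simp

theorem integral_char (K : Z2) :
    ∫ x in cube, char K x = if K = 0 then ((2 * Real.pi) ^ 2 : ℂ) else 0 := by
  have h1 : (volume.restrict cube : Measure (Fin 2 → ℝ)) =
      Measure.pi fun _ => volume.restrict (Set.Icc 0 (2 * Real.pi)) := by
    rw [cube, ← Set.pi_univ_Icc, volume_pi, Measure.restrict_pi_pi]
    rfl
  have h2 (x : Fin 2 → ℝ) : char K x = ∏ j, Complex.exp (Complex.I * ((K j : ℂ) * (x j : ℂ))) := by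
    rw [char, Finset.mul_sum, Complex.exp_sum]
  simp only [h2]
  rw [h1, integral_fintype_prod_eq_prod (f := fun j (y : ℝ) =>
    Complex.exp (Complex.I * ((K j : ℂ) * (y : ℂ))))]
  simp only [integral_exp_Icc]
  rw [Fin.prod_univ_two]
  by_cases hK : K = 0
  · simp [hK, sq]
  · rw [if_neg hK]
    by_cases h0 : K 0 = 0
    · have : K 1 ≠ 0 := fun h1 => hK (by funext j; fin_cases j <;> simp [h0, h1])
      simp [this]
    · simp [h0]

theorem toFun_eq (u : L1) (x : Fin 2 → ℝ) : toFun u x = ∑' k, u k * char k x := rfl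

theorem continuous_toFun (u : L1) : Continuous (toFun u) := by
  refine continuous_tsum (fun k => continuous_const.mul (continuous_char k)) (summable_norm u)
    fun k x => ?_
  change ‖u k * char k x‖ ≤ ‖u k‖
  rw [norm_mul, norm_char, mul_one]

theorem norm_toFun_le (u : L1) (x : Fin 2 → ℝ) : ‖toFun u x‖ ≤ ‖u‖ := by
  rw [norm_eq_tsum, toFun_eq]
  refine tsum_of_norm_bounded (summable_norm u).hasSum fun k => ?_
  change ‖u k * char k x‖ ≤ ‖u k‖
  rw [norm_mul, norm_char, mul_one]

theorem hasSum_toFun_pow (u : L1) (j : ℕ) (x : Fin 2 → ℝ) :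
    HasSum (fun k : Fin (2 * j) → Z2 =>
      mono u k * char (-∑ i : Fin (2 * j), (-1 : ℤ) ^ ((i : ℕ) + 1) • k i) x)
      (((‖toFun u x‖ ^ 2) ^ j : ℝ) : ℂ) := by
  let f (i : Fin (2 * j)) (k : Z2) : ℂ := altL i u k * char (-((-1 : ℤ) ^ ((i : ℕ) + 1) • k)) x
  have h1 := hasSum_prod (f := f) fun i => by
    simpa [f, norm_char, norm_altL_apply] using summable_norm u
  have h2 (i : Fin (2 * j)) : ∑' k, f i k =
      if Odd ((i : ℕ) + 1) then toFun u x else conj (toFun u x) := by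
    split_ifs with h
    · refine tsum_congr fun k => ?_
      simp only [f, altL_apply, if_pos h, h.neg_one_pow, neg_smul, one_smul, neg_neg]
      rfl
    · rw [toFun_eq, Complex.conj_tsum]
      refine tsum_congr fun k => ?_
      simp only [f, altL_apply, if_neg h, (Nat.not_odd_iff_even.1 h).neg_one_pow, one_smul,
        map_mul, conj_char]
  have h3 := prod_pairTuple (M := ℂ) (d := j) 0
    (fun i _ => if Odd (i + 1) then toFun u x else conj (toFun u x))
    (fun _ => toFun u x) (fun _ => conj (toFun u x)) (fun i => by simp)
    (fun i => by simp [parity_simps])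
  rw [Finset.prod_congr rfl fun i _ => h2 i, h3] at h1
  convert! h1 using 1
  · funext k
    rw [mono, ← Finset.sum_neg_distrib, ← prod_char, ← Finset.prod_mul_distrib]
  · simp only [Finset.prod_const, Finset.card_univ, Fintype.card_fin]
    rw [← mul_pow, Complex.mul_conj, Complex.normSq_eq_norm_sq]
    push_cast; rfl

/-- Expanding |u|^(2j) = (uū)^j into characters, orthogonality on the torus keeps exactly the
neutral tuples. -/
theorem integral_toFun_pow (u : L1) (j : ℕ) :
    ∫ x in cube, (‖toFun u x‖ ^ 2) ^ j =
      (2 * Real.pi) ^ 2 * (polyHam (fun _ => 1) (norm_one_le (2 * j)) u).re := by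
  have hm := (hasSum_norm_prod (ι := Fin (2 * j)) fun _ => u).summable
  have hint (k : Fin (2 * j) → Z2) : Integrable (fun x =>
      mono u k * char (-∑ i : Fin (2 * j), (-1 : ℤ) ^ ((i : ℕ) + 1) • k i) x)
      (volume.restrict cube) :=
    (continuous_const.mul (continuous_char _)).continuousOn.integrableOn_compact isCompact_Icc
  have h1 := hasSum_integral_of_summable_integral_norm hint (by
    refine (hm.mul_left ((volume.restrict cube).real Set.univ)).congr fun k => ?_
    simp [norm_char, norm_mono])
  have h2 : ∀ x, ∑' k : Fin (2 * j) → Z2, mono u k *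
      char (-∑ i : Fin (2 * j), (-1 : ℤ) ^ ((i : ℕ) + 1) • k i) x =
      (((‖toFun u x‖ ^ 2) ^ j : ℝ) : ℂ) := fun x => (hasSum_toFun_pow u j x).tsum_eq
  simp only [h2, integral_const_mul, integral_char, neg_eq_zero] at h1
  rw [integral_complex_ofReal] at h1
  have h3 := (hasSum_polyHam (norm_one_le (2 * j)) u).mul_left ((2 * Real.pi) ^ 2 : ℂ)
  have h4 := h1.unique (h3.congr_fun fun k => ?_)
  · have := congrArg Complex.re h4
    rw [Complex.ofReal_re] at this
    rw [this, ← Complex.re_ofReal_mul]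
    push_cast; rfl
  · rw [neutralCoeff, Neutral]
    split_ifs <;> ring

/-! ### Power series in `|u|²` averaged over the torus -/

theorem norm_polyHam_le {n : ℕ} {c : (Fin n → Z2) → ℂ} (hc : ∀ k, ‖c k‖ ≤ 1) (u : L1) :
    ‖polyHam c hc u‖ ≤ ‖u‖ ^ n := by
  refine ((polyForm c hc).le_opNorm _).trans ?_
  simp only [norm_altL, Finset.prod_const, Finset.card_univ, Fintype.card_fin]
  exact mul_le_of_le_one_left (by positivity) (norm_tupleLift_le _)

/-- The average over the torus of `∑ⱼ γⱼ |u(x)|^{2j}`, in Fourier coordinates. -/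
def serHam (γ : ℕ → ℝ) (u : L1) : ℝ :=
  ∑' j, γ j * (polyHam (fun _ => 1) (norm_one_le (2 * j)) u).re

/-- The Hamiltonian vector field of `serHam γ`. -/
def serField (γ : ℕ → ℝ) (u : L1) : L1 :=
  ∑' j, γ j • polyField (fun _ => 1) (norm_one_le (2 * j)) u

/-- Geometric decay of the coefficients, and a zero of order at least `d + 1`. -/
structure Decay (d : ℕ) (γ : ℕ → ℝ) (C δ : ℝ) : Prop where
  pos : 0 < δ
  nonneg : 0 ≤ C
  bound : ∀ j, |γ j| * (4 * δ ^ 2) ^ j ≤ C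
  zero : ∀ j ≤ d, γ j = 0

section Series

variable {d : ℕ} {γ : ℕ → ℝ} {C δ : ℝ}

/-- Only j > d occurs. The powers of ‖u‖ beyond 2d + 1 are absorbed by powers of δ, and the factor 4
in the decay condition leaves 4⁻ʲ, which pays for the factor 2j from differentiation. -/
theorem Decay.norm_field_le (h : Decay d γ C δ) {u : L1} (hu : ‖u‖ ≤ δ) (j : ℕ) :
    ‖γ j • polyField (fun _ => 1) (norm_one_le (2 * j)) u‖ ≤
      C / δ ^ (2 * d + 2) * ‖u‖ ^ (2 * d + 1) * (2 * (j ^ 1 * (1 / 4 : ℝ) ^ j)) := by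
  have hδ := h.pos
  have hC := h.nonneg
  rcases Nat.lt_or_ge d j with hj | hj
  · obtain ⟨l, rfl⟩ := Nat.exists_eq_add_of_lt hj
    rw [norm_smul, Real.norm_eq_abs]
    set j := d + l + 1 with hjdef
    have h1 := norm_polyField_le (norm_one_le (2 * j)) u
    have h2 : ‖u‖ ^ (2 * j - 1) ≤ ‖u‖ ^ (2 * d + 1) * δ ^ (2 * l) := by
      rw [show 2 * j - 1 = (2 * d + 1) + 2 * l by omega, pow_add]
      gcongr
    have h3 := h.bound j
    have h4 : |γ j| ≤ C / (4 * δ ^ 2) ^ j := (le_div_iff₀ (by positivity)).2 h3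
    calc |γ j| * ‖polyField (fun _ => 1) (norm_one_le (2 * j)) u‖
        ≤ C / (4 * δ ^ 2) ^ j * ((2 * j : ℕ) * (‖u‖ ^ (2 * d + 1) * δ ^ (2 * l))) := by
          refine mul_le_mul h4 (h1.trans ?_) (norm_nonneg _) (by positivity)
          gcongr
      _ = _ := by
          have e : (4 * δ ^ 2) ^ j = 4 ^ j * (δ ^ (2 * d + 2) * δ ^ (2 * l)) := by
            rw [mul_pow, ← pow_mul, ← pow_add]
            congr 2; omega
          rw [e, one_div, inv_pow]
          push_cast
          field_simp
  · rw [h.zero j hj, zero_smul, norm_zero]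
    positivity

theorem summable_decay : Summable fun j : ℕ => 2 * ((j : ℝ) ^ 1 * (1 / 4 : ℝ) ^ j) :=
  (summable_pow_mul_geometric_of_norm_lt_one 1 (by norm_num : ‖(1 / 4 : ℝ)‖ < 1)).mul_left 2

theorem Decay.summable_field (h : Decay d γ C δ) {u : L1} (hu : ‖u‖ ≤ δ) :
    Summable fun j => γ j • polyField (fun _ => 1) (norm_one_le (2 * j)) u :=
  Summable.of_norm_bounded (summable_decay.mul_left _) (h.norm_field_le hu)

theorem Decay.norm_serField_le (h : Decay d γ C δ) {u : L1} (hu : ‖u‖ ≤ δ) :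
    ‖serField γ u‖ ≤ (C / δ ^ (2 * d + 2) * ∑' j : ℕ, 2 * ((j : ℝ) ^ 1 * (1 / 4 : ℝ) ^ j)) *
      ‖u‖ ^ (2 * d + 1) := by
  refine (tsum_of_norm_bounded (summable_decay.mul_left _).hasSum
    (h.norm_field_le hu)).trans_eq ?_
  rw [tsum_mul_left]; ring

theorem Decay.hasFDerivAt (h : Decay d γ C δ) {u : L1} (hu : ‖u‖ < δ) :
    HasFDerivAt (serHam γ) (sympl.flip (serField γ u)) u := by
  have hball : u ∈ Metric.ball (0 : L1) δ := by simpa using hu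
  have h1 := hasFDerivAt_tsum_of_isPreconnected
    (f := fun (j : ℕ) u => γ j * (polyHam (fun _ => 1) (norm_one_le (2 * j)) u).re)
    (f' := fun (j : ℕ) u => γ j • sympl.flip (polyField (fun _ => 1) (norm_one_le (2 * j)) u))
    (u := fun j : ℕ => C / δ ^ (2 * d + 2) * δ ^ (2 * d + 1) *
      (2 * ((j : ℝ) ^ 1 * (1 / 4 : ℝ) ^ j))) (x₀ := 0)
    (summable_decay.mul_left _) Metric.isOpen_ball (convex_ball _ _).isPreconnected
    (fun j v _ => (hasFDerivAt_polyHam (norm_one_le (2 * j)) v).const_mul (γ j))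
    (fun j v hv => ?_) (Metric.mem_ball_self h.pos) ?_ hball
  · refine h1.congr_fderiv ?_
    rw [serField, sympl.flip.map_tsum (h.summable_field hu.le)]
    exact tsum_congr fun j => (map_smul _ _ _).symm
  · have hv' : ‖v‖ ≤ δ := by simpa using (Metric.mem_ball.1 hv).le
    have hC := h.nonneg
    have hδ := h.pos
    rw [← map_smul]
    have h2 : ‖sympl.flip (γ j • polyField (fun _ => 1) (norm_one_le (2 * j)) v)‖ ≤
        ‖γ j • polyField (fun _ => 1) (norm_one_le (2 * j)) v‖ :=
      ContinuousLinearMap.opNorm_le_bound _ (norm_nonneg _) fun w => by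
        rw [ContinuousLinearMap.flip_apply, Real.norm_eq_abs]
        exact (abs_sympl_le _ _).trans_eq (mul_comm _ _)
    refine (h2.trans (h.norm_field_le hv' j)).trans ?_
    gcongr
  · refine summable_of_ne_finset_zero (s := {0}) fun j hj => ?_
    have hj0 : 2 * j ≠ 0 := by simpa using hj
    have := norm_polyHam_le (norm_one_le (2 * j)) 0
    rw [norm_zero, zero_pow hj0] at this
    rw [norm_le_zero_iff.1 this]; simp

/-- The power series of `serHam γ`. -/
def serFormal (γ : ℕ → ℝ) : FormalMultilinearSeries ℝ L1 ℝ := fun n =>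
  (if Even n then γ (n / 2) else 0) • Complex.reCLM.compContinuousMultilinearMap
    ((polyForm (fun _ => 1) (norm_one_le n)).compContinuousLinearMap fun i => altL i)

theorem norm_serFormal_le (γ : ℕ → ℝ) (n : ℕ) :
    ‖serFormal γ n‖ ≤ if Even n then |γ (n / 2)| else 0 := by
  rw [serFormal, norm_smul]
  have h1 : ‖Complex.reCLM.compContinuousMultilinearMap
      ((polyForm (fun _ => 1) (norm_one_le n)).compContinuousLinearMap fun i => altL i)‖ ≤ 1 := by
    refine ContinuousMultilinearMap.opNorm_le_bound zero_le_one fun U => ?_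
    refine (Complex.abs_re_le_norm _).trans ?_
    refine ((polyForm (fun _ => 1) (norm_one_le n)).le_opNorm fun i => altL i (U i)).trans ?_
    simp only [norm_altL]
    exact mul_le_mul_of_nonneg_right (norm_tupleLift_le _)
      (Finset.prod_nonneg fun i _ => norm_nonneg (U i))
  refine (mul_le_of_le_one_right (norm_nonneg _) h1).trans_eq ?_
  split_ifs <;> simp

theorem serFormal_sum (γ : ℕ → ℝ) (u : L1) : (serFormal γ).sum u = serHam γ u := by
  have hinj : Function.Injective fun j : ℕ => 2 * j := fun a b hab => by simpa using hab
  rw [FormalMultilinearSeries.sum, serHam, ← hinj.tsum_eq]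
  · refine tsum_congr fun j => ?_
    simp only [serFormal, even_two_mul, if_true, smul_apply, smul_eq_mul]
    rw [Nat.mul_div_cancel_left _ two_pos]
    rfl
  · intro n hn
    by_contra h
    refine hn ?_
    have : ¬ Even n := fun ⟨j, hj⟩ => h ⟨j, by simp only; omega⟩
    simp [serFormal, this]

/-- The field bounds control one derivative; all orders come at once from the convergence of the
power series `serFormal` on the ball. -/
theorem Decay.contDiffOn (h : Decay d γ C δ) :
    ContDiffOn ℝ ∞ (serHam γ) (Metric.ball 0 δ) := by
  have hδ := h.pos
  have hr : ENNReal.ofReal δ ≤ (serFormal γ).radius := by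
    refine FormalMultilinearSeries.le_radius_of_bound _ C (r := δ.toNNReal) fun n => ?_
    rw [Real.coe_toNNReal _ hδ.le]
    refine (mul_le_mul_of_nonneg_right (norm_serFormal_le γ n) (by positivity)).trans ?_
    split_ifs with hn
    · obtain ⟨j, rfl⟩ := hn
      rw [← two_mul, Nat.mul_div_cancel_left _ two_pos]
      refine le_trans ?_ (h.bound j)
      rw [pow_mul]
      gcongr
      nlinarith [sq_nonneg δ]
    · rw [zero_mul]; exact h.nonneg
  have h1 := (serFormal γ).hasFPowerSeriesOnBall
    ((ENNReal.ofReal_pos.2 hδ).trans_le hr)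
  have h2 : (serFormal γ).sum = serHam γ := funext (serFormal_sum γ)
  rw [h2] at h1
  have h3 : AnalyticOnNhd ℝ (serHam γ) (Metric.ball 0 δ) := h1.analyticOnNhd.mono (by
    rw [← Metric.eball_ofReal]
    exact Metric.eball_subset_eball hr)
  exact h3.contDiffOn Metric.isOpen_ball.uniqueDiffOn

/-- On the torus |u(x)| ≤ ‖u‖ ≤ δ, so the series of G is dominated by C·4⁻ʲ and may be integrated
termwise. -/
theorem Decay.integral_eq (h : Decay d γ C δ) {G : ℝ → ℝ}
    (hG : ∀ y, |y| < 4 * δ ^ 2 → HasSum (fun j => γ j * y ^ j) (G y)) {u : L1} (hu : ‖u‖ ≤ δ) :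
    1 / (2 * Real.pi) ^ 2 * ∫ x in cube, G (‖toFun u x‖ ^ 2) = serHam γ u := by
  have hδ := h.pos
  have hle (x : Fin 2 → ℝ) : ‖toFun u x‖ ^ 2 ≤ δ ^ 2 :=
    pow_le_pow_left₀ (norm_nonneg _) ((norm_toFun_le u x).trans hu) 2
  have hb (j : ℕ) (x : Fin 2 → ℝ) : ‖γ j * (‖toFun u x‖ ^ 2) ^ j‖ ≤ C * (1 / 4 : ℝ) ^ j := by
    have h1 := h.bound j
    rw [mul_pow] at h1
    rw [norm_mul, Real.norm_eq_abs, Real.norm_eq_abs, abs_of_nonneg (a := (‖toFun u x‖ ^ 2) ^ j)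
      (by positivity), one_div, inv_pow, ← div_eq_mul_inv, le_div_iff₀ (by positivity)]
    refine le_trans ?_ h1
    rw [mul_assoc, mul_comm (4 ^ j)]
    gcongr
    exact (norm_toFun_le u x).trans hu
  have hgeo : Summable fun j : ℕ => C * (1 / 4 : ℝ) ^ j :=
    (summable_geometric_of_lt_one (by norm_num) (by norm_num)).mul_left C
  have h1 := hasSum_integral_of_dominated_convergence (μ := volume.restrict cube)
    (F := fun (j : ℕ) x => γ j * (‖toFun u x‖ ^ 2) ^ j) (f := fun x => G (‖toFun u x‖ ^ 2))
    (fun j _ => C * (1 / 4 : ℝ) ^ j)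
    (fun j => (continuous_const.mul
      (((continuous_toFun u).norm.pow 2).pow j)).aestronglyMeasurable)
    (fun j => Filter.Eventually.of_forall fun x => hb j x)
    (Filter.Eventually.of_forall fun _ => hgeo) (integrable_const _)
    (Filter.Eventually.of_forall fun x => hG _ (by
      rw [abs_of_nonneg (sq_nonneg _)]
      have := hle x
      have : 0 < δ ^ 2 := by positivity
      linarith))
  simp only [integral_const_mul, integral_toFun_pow] at h1
  have h2 := (h1.mul_left (1 / (2 * Real.pi) ^ 2)).tsum_eq
  rw [← h2, serHam]
  refine tsum_congr fun j => ?_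
  have := Real.pi_ne_zero
  field_simp

end Series

theorem exists_decay {d : ℕ} {G : ℝ → ℝ} (hG : AnalyticAt ℝ G 0)
    (hG0 : ((d + 1 : ℕ) : ℕ∞) ≤ analyticOrderAt G 0) :
    ∃ γ C δ, Decay d γ C δ ∧
      ∀ y, |y| < 4 * δ ^ 2 → HasSum (fun j => γ j * y ^ j) (G y) := by
  obtain ⟨R, hR⟩ := hG.hasFPowerSeriesAt
  rw [natCast_le_analyticOrderAt_iff_iteratedDeriv_eq_zero hG] at hG0
  obtain ⟨r, hr0, hrR⟩ := ENNReal.lt_iff_exists_nnreal_btwn.1 hR.r_pos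
  obtain ⟨C, hC, hb⟩ := FormalMultilinearSeries.norm_mul_pow_le_of_lt_radius _
    (hrR.trans_le hR.r_le)
  have hr0' : (0 : ℝ) < r := by exact_mod_cast hr0
  -- The choice δ = √(r/4) makes 4δ² the radius `r`, chosen strictly inside the disc of convergence.
  have hδ : 4 * (Real.sqrt (r / 4)) ^ 2 = r := by
    rw [Real.sq_sqrt (by positivity)]; ring
  refine ⟨fun n => iteratedDeriv n G 0 / n.factorial, C, Real.sqrt (r / 4),
    ⟨Real.sqrt_pos.2 (by positivity), hC.le, fun j => ?_, fun j hj => ?_⟩, fun y hy => ?_⟩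
  · rw [hδ]
    have := hb j
    rwa [FormalMultilinearSeries.ofScalars_norm, Real.norm_eq_abs] at this
  · rw [hG0 j (by omega), zero_div]
  · rw [hδ] at hy
    have := hR.hasSum (y := y) (by
      rw [Metric.mem_eball, edist_zero_right]
      refine lt_trans ?_ hrR
      rw [← ofReal_norm, Real.norm_eq_abs, ← ENNReal.ofReal_coe_nnreal]
      exact (ENNReal.ofReal_lt_ofReal_iff hr0').2 hy)
    rw [zero_add] at this
    refine this.congr_fun fun j => ?_
    rw [FormalMultilinearSeries.ofScalars_apply_eq, smul_eq_mul]

/-! ### The remainder of the normal form -/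

/-- The Lipschitz constant on a ball of radius t > ‖u‖ bounds the derivative; then t ↓ ‖u‖. -/
theorem norm_fderiv_polyField_le {n : ℕ} {c : (Fin n → Z2) → ℂ} (hc : ∀ k, ‖c k‖ ≤ 1) (u : L1) :
    ‖fderiv ℝ (polyField c hc) u‖ ≤ n * (n - 1 : ℕ) * ‖u‖ ^ (n - 2) := by
  have hd := (((contDiff_polyField hc).differentiable (by simp)) u).hasFDerivAt
  have h1 (t : ℝ) (ht : ‖u‖ < t) :
      ‖fderiv ℝ (polyField c hc) u‖ ≤ n * (n - 1 : ℕ) * t ^ (n - 2) := by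
    have ht0 : 0 ≤ t := (norm_nonneg u).trans ht.le
    refine hd.le_of_lip' (by positivity) ?_
    filter_upwards [continuous_norm.continuousAt.eventually_lt_const ht] with v hv
    refine (norm_polyField_sub_le hc v u).trans ?_
    rw [← mul_assoc, ← mul_assoc]
    gcongr
    exact max_le hv.le ht.le
  have h2 : Filter.Tendsto (fun t : ℝ => (n : ℝ) * (n - 1 : ℕ) * t ^ (n - 2))
      (nhdsWithin ‖u‖ (Set.Ioi ‖u‖)) (nhds (n * (n - 1 : ℕ) * ‖u‖ ^ (n - 2))) :=
    (Continuous.tendsto (by fun_prop) _).mono_left nhdsWithin_le_nhds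
  refine ge_of_tendsto h2 ?_
  filter_upwards [self_mem_nhdsWithin] with t ht
  exact h1 t ht

/-- Transposition for Ω turns A into −A. Since v = (1 − A/2)pv, one has Ω(v, y) = Ω(pv, (1 + A/2)y),
while DΓ = (1 + A/2)p puts 1 − A/2 on the fields at Γ(a). Thus `y` represents all terms except the
one at `a`, and no transpose of Dm is needed. -/
theorem hasFDerivAt_remainder {Z P g : L1 → ℝ} {m Γ : L1 → L1} {p A : L1 →L[ℝ] L1}
    {a y zm za pΓ pm q : L1}
    (hZm : HasFDerivAt Z (sympl.flip zm) (m a)) (hZa : HasFDerivAt Z (sympl.flip za) a)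
    (hPΓ : HasFDerivAt P (sympl.flip pΓ) (Γ a)) (hPm : HasFDerivAt P (sympl.flip pm) (m a))
    (hg : HasFDerivAt g (sympl.flip q) (Γ a)) (hm : HasFDerivAt m p a)
    (hΓ : HasFDerivAt Γ (p + (1 / 2 : ℝ) • (A ∘L p)) a)
    (hp : ∀ v, p v - (1 / 2 : ℝ) • A (p v) = v)
    (hA : ∀ v w, sympl (A v) w = -sympl v (A w))
    (hy : y + (1 / 2 : ℝ) • A y = zm - pm + ((pΓ + q) - (1 / 2 : ℝ) • A (pΓ + q))) :
    HasFDerivAt (fun a => Z (m a) - Z a + (P (Γ a) - P (m a)) + g (Γ a))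
      (sympl.flip (y - za)) a := by
  have h := (((hZm.comp a hm).sub hZa).add ((hPΓ.comp a hΓ).sub (hPm.comp a hm))).add
    (hg.comp a hΓ)
  refine h.congr_fderiv ?_
  ext v
  have h1 : sympl v y = sympl (p v) (y + (1 / 2 : ℝ) • A y) := by
    conv_lhs => rw [← hp v]
    simp only [map_add, map_sub, map_smul, sub_apply, smul_apply, hA, smul_eq_mul]
    ring
  rw [hy] at h1
  simp only [map_add, map_sub, map_smul, smul_eq_mul] at h1
  simp only [add_apply, sub_apply, smul_apply, ContinuousLinearMap.comp_apply,
    ContinuousLinearMap.flip_apply, map_add, map_sub, map_smul, hA, smul_eq_mul, h1]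
  ring

theorem norm_remainder_le {E : Type*} [NormedAddCommGroup E] [NormedSpace ℝ E]
    {A : E →L[ℝ] E} (hA : ‖A‖ < 1) {y zm za pΓ pm q : E} {ε κ : ℝ}
    (hy : y + (1 / 2 : ℝ) • A y = zm - pm + ((pΓ + q) - (1 / 2 : ℝ) • A (pΓ + q)))
    (h1 : ‖zm - za‖ ≤ ε) (h2 : ‖pΓ - pm‖ ≤ ε) (h3 : ‖A pΓ‖ ≤ ε) (h4 : ‖A za‖ ≤ ε)
    (h5 : ‖q‖ ≤ κ) : ‖y - za‖ ≤ 2 * (3 * ε + 2 * κ) := by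
  -- The equation for `y` is regrouped into differences of fields at nearby points and terms
  -- containing `A`, so that every term except those in `q` is small to higher order.
  have h6 : (y - za) + (1 / 2 : ℝ) • A (y - za) = (zm - za) + (pΓ - pm) -
      (1 / 2 : ℝ) • A pΓ - (1 / 2 : ℝ) • A za + (q - (1 / 2 : ℝ) • A q) := by
    calc (y - za) + (1 / 2 : ℝ) • A (y - za)
        = (y + (1 / 2 : ℝ) • A y) - za - (1 / 2 : ℝ) • A za := by rw [map_sub]; module
      _ = _ := by rw [hy, map_add]; module
  refine (norm_le_of_id_add_half hA h6).trans (mul_le_mul_of_nonneg_left ?_ zero_le_two)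
  have hhalf (x : E) : ‖(1 / 2 : ℝ) • x‖ = 1 / 2 * ‖x‖ := by rw [norm_smul]; norm_num
  have h7 := A.le_of_opNorm_le hA.le q
  have e1 := norm_add_le ((zm - za) + (pΓ - pm) - (1 / 2 : ℝ) • A pΓ - (1 / 2 : ℝ) • A za)
    (q - (1 / 2 : ℝ) • A q)
  have e2 := norm_sub_le ((zm - za) + (pΓ - pm) - (1 / 2 : ℝ) • A pΓ) ((1 / 2 : ℝ) • A za)
  have e3 := norm_sub_le ((zm - za) + (pΓ - pm)) ((1 / 2 : ℝ) • A pΓ)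
  have e4 := norm_add_le (zm - za) (pΓ - pm)
  have e5 := norm_sub_le q ((1 / 2 : ℝ) • A q)
  rw [hhalf] at e2 e3 e5
  linarith [norm_nonneg q]

theorem nlsHam_eq {d : ℕ} {G : ℝ → ℝ} {γ : ℕ → ℝ} {C δ : ℝ} (h : Decay d γ C δ)
    (hG : ∀ y, |y| < 4 * δ ^ 2 → HasSum (fun j => γ j * y ^ j) (G y)) {u : L1} (hu : ‖u‖ ≤ δ) :
    nlsHam d G u = ((quadHam u + (polyHam (fun _ => 1) (norm_one_le (2 * d)) u).re +
      serHam γ u : ℝ) : ℂ) := by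
  rw [nlsHam, nonlinHam, tsum_zeroMomentum, ← h.integral_eq hG hu,
    polyHam_real (norm_one_le (2 * d)) (fun _ => (map_one _).symm)]
  push_cast [cube, Complex.ofReal_re]
  ring

end FourierNLS

end


/-! ### The normal form theorem -/

theorem mainTheorem5 (d : ℕ) (hd : 2 ≤ d) (G : ℝ → ℝ)
    (hG : AnalyticOnNhd ℝ G (Metric.ball 0 1))
    (hG0 : ((d + 1 : ℕ) : ℕ∞) ≤ analyticOrderAt G 0) :
    ∃ η : ℝ, 0 < η ∧ 2 * η < 1 ∧
    ∃ (Γ : OpenPartialHomeomorph FourierNLS.L1 FourierNLS.L1) (R : FourierNLS.L1 → ℝ),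
      -- `Γ` is a smooth change of coordinates on a neighbourhood of `B(η)`, and `R` is smooth
      Metric.closedBall (0 : FourierNLS.L1) η ⊆ Γ.source ∧
      ContDiffOn ℝ ∞ Γ Γ.source ∧
      ContDiffOn ℝ ∞ Γ.symm Γ.target ∧
      ContDiffOn ℝ ∞ R Γ.source ∧
      Set.MapsTo Γ (Metric.closedBall 0 η) (Metric.closedBall 0 (2 * η)) ∧
      -- `Γ` is symplectic
      (∀ a ∈ Metric.closedBall (0 : FourierNLS.L1) η, ∀ v w : FourierNLS.L1,
        FourierNLS.symplForm (fderiv ℝ Γ a v) (fderiv ℝ Γ a w) = FourierNLS.symplForm v w) ∧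
      -- `ℋ ∘ Γ` and `𝒟` have the same domain in `B(η)`, and `ℋ ∘ Γ = 𝒟 + H_Res + R` there
      (∀ a ∈ Metric.closedBall (0 : FourierNLS.L1) η,
        (FourierNLS.FiniteEnergy (Γ a) ↔ FourierNLS.FiniteEnergy a) ∧
        (FourierNLS.FiniteEnergy a →
          FourierNLS.nlsHam d G (Γ a) =
            (FourierNLS.quadHam a : ℂ) + FourierNLS.resHam d a + (R a : ℂ))) ∧
      -- the two expressions of `H_Res`
      (∀ a ∈ Metric.closedBall (0 : FourierNLS.L1) η,
        FourierNLS.resHam d a = FourierNLS.resHamMulti d a) ∧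
      -- `‖X_R‖ = O(‖a‖^(2d+1))`
      (∃ C : ℝ, ∀ a ∈ Metric.closedBall (0 : FourierNLS.L1) η,
        (Summable fun k => ‖FourierNLS.hamField R a k‖) ∧
        ∑' k, ‖FourierNLS.hamField R a k‖ ≤ C * ‖a‖ ^ (2 * d + 1)) ∧
      -- `‖Γ - Id‖ = O(‖a‖^(2d-1))`
      (∃ C : ℝ, ∀ a ∈ Metric.closedBall (0 : FourierNLS.L1) η,
        ‖Γ a - a‖ ≤ C * ‖a‖ ^ (2 * d - 1)) := by
  open FourierNLS in
  obtain ⟨γ, C, δ, hγ, hGs⟩ := exists_decay (hG 0 (by simp)) hG0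
  have hδ := hγ.pos
  let n := 2 * d
  have hn : 4 ≤ n := by omega
  have hn0 : (4 : ℝ) ≤ n := by exact_mod_cast hn
  let X : L1 → L1 := polyField (homCoeff n) (norm_homCoeff_le n)
  let Xz : L1 → L1 := polyField (resCoeff n) (norm_resCoeff_le n)
  let Xp : L1 → L1 := polyField (fun _ => 1) (norm_one_le n)
  let Z (u : L1) : ℝ := (polyHam (resCoeff n) (norm_resCoeff_le n) u).re
  let P (u : L1) : ℝ := (polyHam (fun _ => 1) (norm_one_le n) u).re
  have hX : ContDiff ℝ ∞ X := (contDiff_polyField _).of_le le_top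
  have hZ : ContDiff ℝ ∞ Z := Complex.reCLM.contDiff.comp ((contDiff_polyHam _).of_le le_top)
  have hP : ContDiff ℝ ∞ P := Complex.reCLM.contDiff.comp ((contDiff_polyHam _).of_le le_top)
  have hdX (u : L1) : ‖fderiv ℝ X u‖ ≤ n * (n - 1 : ℕ) * ‖u‖ ^ (n - 2) :=
    norm_fderiv_polyField_le _ u
  have hX0 : X 0 = 0 := by
    have := norm_polyField_le (norm_homCoeff_le n) 0
    rw [norm_zero, zero_pow (by omega), mul_zero] at this
    exact norm_le_zero_iff.1 this
  have hdX0 : fderiv ℝ X 0 = 0 := by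
    have := hdX 0
    rw [norm_zero, zero_pow (by omega), mul_zero] at this
    exact norm_le_zero_iff.1 this
  -- The bound δ/2 keeps Γ(a) where the series of G converges; 1/(2n²) gives the smallness of the
  -- midpoint required by the energy estimate.
  let ρ : ℝ := min (δ / 2) (1 / (2 * n ^ 2))
  have hρ : 0 < ρ := lt_min (by positivity) (by positivity)
  obtain ⟨Γ, m, h0s, hΓ, hΓs, hm, hprop⟩ := exists_cayley hX hX0 hdX0 (Metric.ball_mem_nhds 0 hρ)
  have hsmall (a : L1) (ha : a ∈ Γ.source) :
      n * (n - 1 : ℕ) * ‖m a‖ ^ (n - 2) ≤ 1 / 2 ∧ n * ‖m a‖ ^ (n - 2) ≤ 1 / 2 := by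
    have h1 : ‖m a‖ < ρ := by simpa using (hprop a ha).1
    have h2 : ‖m a‖ ≤ 1 / (2 * n ^ 2) := h1.le.trans (min_le_right _ _)
    have h3 : (1 : ℝ) / (2 * n ^ 2) ≤ 1 := (div_le_one (by positivity)).2 (by nlinarith)
    have h4 : ‖m a‖ ^ (n - 2) ≤ 1 / (2 * n ^ 2) :=
      (pow_le_of_le_one (norm_nonneg _) (h2.trans h3) (by omega)).trans h2
    have h5 : ((n - 1 : ℕ) : ℝ) ≤ n := by exact_mod_cast Nat.sub_le n 1
    constructor
    · calc n * (n - 1 : ℕ) * ‖m a‖ ^ (n - 2) ≤ n * n * (1 / (2 * n ^ 2)) := by gcongr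
        _ = 1 / 2 := by field_simp
    · calc n * ‖m a‖ ^ (n - 2) ≤ n * n * (1 / (2 * n ^ 2)) := by
            gcongr; nlinarith
        _ = 1 / 2 := by field_simp
  have hXm (a : L1) (ha : a ∈ Γ.source) : ‖X (m a)‖ ≤ 1 / 2 * ‖m a‖ := by
    refine (norm_polyField_le _ _).trans ?_
    rw [show n - 1 = n - 2 + 1 by omega, pow_succ, ← mul_assoc]
    exact mul_le_mul_of_nonneg_right (hsmall a ha).2 (norm_nonneg _)
  have hhalf (x : L1) : ‖(1 / 2 : ℝ) • x‖ = 1 / 2 * ‖x‖ := by rw [norm_smul]; norm_num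
  -- The half step X(m)/2 has norm at most ‖m‖/4, whence the factors 4/3 and 5/4; their product 5/3
  -- is below 2.
  have hma (a : L1) (ha : a ∈ Γ.source) : ‖m a‖ ≤ 4 / 3 * ‖a‖ := by
    have h1 := norm_sub_norm_le (m a) ((1 / 2 : ℝ) • X (m a))
    rw [(hprop a ha).2.1, hhalf] at h1
    linarith [hXm a ha]
  have hΓm (a : L1) (ha : a ∈ Γ.source) : ‖Γ a‖ ≤ 5 / 4 * ‖m a‖ := by
    have h1 := norm_add_le (m a) ((1 / 2 : ℝ) • X (m a))
    rw [← (hprop a ha).2.2, hhalf] at h1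
    linarith [hXm a ha]
  have hΓδ (a : L1) (ha : a ∈ Γ.source) : ‖Γ a‖ < δ := by
    have h1 : ‖m a‖ < ρ := by simpa using (hprop a ha).1
    have h2 : ‖m a‖ < δ / 2 := h1.trans_le (min_le_left _ _)
    linarith [hΓm a ha]
  obtain ⟨ε, hε, hεs⟩ := Metric.isOpen_iff.1 Γ.open_source 0 h0s
  have hball : Metric.closedBall (0 : L1) (min (ε / 2) (1 / 4)) ⊆ Γ.source := fun a ha => by
    refine hεs ?_
    rw [mem_closedBall_zero_iff] at ha
    rw [mem_ball_zero_iff]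
    linarith [min_le_left (ε / 2) (1 / 4)]
  -- The bound ε/2 places the closed ball in the source; 1/4 gives 2η < 1 and 2‖a‖ ≤ 1.
  refine ⟨min (ε / 2) (1 / 4), lt_min (by positivity) (by norm_num),
    by linarith [min_le_right (ε / 2) (1 / 4)], Γ,
    fun a => Z (m a) - Z a + (P (Γ a) - P (m a)) + serHam γ (Γ a), hball, hΓ, hΓs, ?_, ?_, ?_,
    ?_, fun a _ => resHam_eq_resHamMulti d a, ?_, ?_⟩
  · refine (((hZ.comp_contDiffOn hm).sub hZ.contDiffOn).add
      ((hP.comp_contDiffOn hΓ).sub (hP.comp_contDiffOn hm))).add (hγ.contDiffOn.comp hΓ ?_)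
    intro a ha
    simpa using hΓδ a ha
  · intro a ha
    have has := hball ha
    rw [mem_closedBall_zero_iff] at ha ⊢
    linarith [hma a has, hΓm a has, norm_nonneg a]
  · intro a ha v w
    have has := hball ha
    obtain ⟨h1, h2⟩ := fderiv_cayley hX Γ.open_source hm (fun a ha => (hprop a ha).2) has
    have hA := sympl_fderiv_antisymm (hasFDerivAt_polyHam (norm_homCoeff_le n))
      (hX.differentiable (by simp)) (m a)
    rw [symplForm_eq, symplForm_eq, h2.fderiv]
    have := sympl_cayley hA (fderiv ℝ m a v) (fderiv ℝ m a w)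
    rw [h1, h1] at this
    exact congrArg _ this
  · intro a ha
    have has := hball ha
    obtain ⟨-, h1, h2⟩ := hprop a has
    have hs := (hsmall a has).1
    have hfin := finiteEnergy_cayley (norm_homCoeff_le n) hs
    have hquad := quadHam_cayley (norm_homCoeff_le n) hs
    rw [tsum_homological] at hquad
    change FiniteEnergy (m a + (1 / 2 : ℝ) • X (m a)) ↔
      FiniteEnergy (m a - (1 / 2 : ℝ) • X (m a)) at hfin
    change FiniteEnergy (m a - (1 / 2 : ℝ) • X (m a)) → quadHam (m a + (1 / 2 : ℝ) • X (m a)) =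
      quadHam (m a - (1 / 2 : ℝ) • X (m a)) + (Z (m a) - P (m a)) at hquad
    rw [h1, ← h2] at hfin hquad
    refine ⟨hfin, fun hE => ?_⟩
    rw [nlsHam_eq hγ hGs (hΓδ a has).le, hquad hE, resHam_real]
    change ((quadHam a + (Z (m a) - P (m a)) + P (Γ a) + serHam γ (Γ a) : ℝ) : ℂ) =
      (quadHam a : ℂ) + (Z a : ℂ) +
        ((Z (m a) - Z a + (P (Γ a) - P (m a)) + serHam γ (Γ a) : ℝ) : ℂ)
    push_cast
    ring
  · let K : ℝ := C / δ ^ (2 * d + 2) * ∑' j : ℕ, 2 * ((j : ℝ) ^ 1 * (1 / 4 : ℝ) ^ j)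
    let M : ℝ := n * (n - 1 : ℕ) * n
    refine ⟨2 * (3 * M + 2 * K) * 2 ^ (2 * d + 1), fun a ha => ?_⟩
    have has := hball ha
    obtain ⟨h1, h2⟩ := fderiv_cayley hX Γ.open_source hm (fun a ha => (hprop a ha).2) has
    obtain ⟨-, hm1, hm2⟩ := hprop a has
    have hA := sympl_fderiv_antisymm (hasFDerivAt_polyHam (norm_homCoeff_le n))
      (hX.differentiable (by simp)) (m a)
    have hA1 : ‖fderiv ℝ X (m a)‖ < 1 :=
      ((hdX (m a)).trans (hsmall a has).1).trans_lt (by norm_num)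
    -- Solvable because 1 + A/2 is invertible for ‖A‖ < 1. The field of the remainder is y − X_Z(a).
    obtain ⟨y, hy⟩ := exists_id_add_half hA1 (Xz (m a) - Xp (m a) +
      ((Xp (Γ a) + serField γ (Γ a)) - (1 / 2 : ℝ) • fderiv ℝ X (m a)
        (Xp (Γ a) + serField γ (Γ a))))
    have hderiv := hasFDerivAt_remainder
      (hasFDerivAt_polyHam (norm_resCoeff_le n) (m a)) (hasFDerivAt_polyHam (norm_resCoeff_le n) a)
      (hasFDerivAt_polyHam (norm_one_le n) (Γ a)) (hasFDerivAt_polyHam (norm_one_le n) (m a))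
      (hγ.hasFDerivAt (hΓδ a has))
      ((hm.contDiffAt (Γ.open_source.mem_nhds has)).differentiableAt (by simp)).hasFDerivAt
      h2 h1 hA hy
    have hfield : ∀ k, hamField
        (fun a => Z (m a) - Z a + (P (Γ a) - P (m a)) + serHam γ (Γ a)) a k = (y - Xz a) k :=
      hamField_eq hderiv
    simp only [hfield]
    refine ⟨summable_norm _, ?_⟩
    rw [← norm_eq_tsum]
    rw [mem_closedBall_zero_iff] at ha
    set t := 2 * ‖a‖ with ht
    have ht0 : 0 ≤ t := by positivity
    have ht1 : t ≤ 1 := by linarith [min_le_right (ε / 2) (1 / 4)]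
    have hat : ‖a‖ ≤ t := by linarith [norm_nonneg a]
    have hmt : ‖m a‖ ≤ t := by linarith [hma a has, norm_nonneg a]
    have hΓt : ‖Γ a‖ ≤ t := by linarith [hma a has, hΓm a has, norm_nonneg a]
    -- The exponent on the left is 2n − 3 = 4d − 3, at least 2d + 1 because d ≥ 2.
    have hpow : t ^ (n - 2) * t ^ (n - 1) ≤ t ^ (2 * d + 1) := by
      rw [← pow_add]
      exact pow_le_pow_of_le_one ht0 ht1 (by omega)
    have hXt : ‖(1 / 2 : ℝ) • X (m a)‖ ≤ n * t ^ (n - 1) := by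
      rw [hhalf]
      have h3 : ‖X (m a)‖ ≤ n * ‖m a‖ ^ (n - 1) := norm_polyField_le _ _
      have h4 : (n : ℝ) * ‖m a‖ ^ (n - 1) ≤ n * t ^ (n - 1) := by gcongr
      linarith [norm_nonneg (X (m a))]
    have hlip {c : (Fin n → Z2) → ℂ} (hc : ∀ k, ‖c k‖ ≤ 1) {u v : L1} (hu : ‖u‖ ≤ t)
        (hv : ‖v‖ ≤ t) (huv : u - v = (1 / 2 : ℝ) • X (m a)) :
        ‖polyField c hc u - polyField c hc v‖ ≤ M * t ^ (2 * d + 1) := by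
      refine (norm_polyField_sub_le hc u v).trans ?_
      rw [huv]
      calc (n : ℝ) * ((n - 1 : ℕ) * max ‖u‖ ‖v‖ ^ (n - 2) * ‖(1 / 2 : ℝ) • X (m a)‖)
          ≤ n * ((n - 1 : ℕ) * t ^ (n - 2) * (n * t ^ (n - 1))) := by
            gcongr
            exact max_le hu hv
        _ = M * (t ^ (n - 2) * t ^ (n - 1)) := by simp only [M]; ring
        _ ≤ _ := mul_le_mul_of_nonneg_left hpow (by positivity)
    have hop {c : (Fin n → Z2) → ℂ} (hc : ∀ k, ‖c k‖ ≤ 1) {u : L1} (hu : ‖u‖ ≤ t) :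
        ‖fderiv ℝ X (m a) (polyField c hc u)‖ ≤ M * t ^ (2 * d + 1) := by
      calc ‖fderiv ℝ X (m a) (polyField c hc u)‖
          ≤ (n * (n - 1 : ℕ) * ‖m a‖ ^ (n - 2)) * (n * ‖u‖ ^ (n - 1)) :=
            (fderiv ℝ X (m a)).le_of_opNorm_le_of_le (hdX (m a)) (norm_polyField_le hc u)
        _ ≤ (n * (n - 1 : ℕ) * t ^ (n - 2)) * (n * t ^ (n - 1)) := by gcongr
        _ = M * (t ^ (n - 2) * t ^ (n - 1)) := by simp only [M]; ring
        _ ≤ _ := mul_le_mul_of_nonneg_left hpow (by positivity)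
    have hK : 0 ≤ K := mul_nonneg (div_nonneg hγ.nonneg (by positivity))
      (tsum_nonneg fun j => by positivity)
    have hq : ‖serField γ (Γ a)‖ ≤ K * t ^ (2 * d + 1) :=
      (hγ.norm_serField_le (hΓδ a has).le).trans (by gcongr)
    refine (norm_remainder_le hA1 hy (hlip _ hmt hat ?_) (hlip _ hΓt hmt ?_) (hop _ hΓt)
      (hop _ hat) hq).trans_eq ?_
    · conv_lhs => arg 2; rw [← hm1]
      abel
    · rw [hm2]; abel
    · rw [ht, mul_pow]; ring
  · refine ⟨n * 2 ^ (2 * d - 1), fun a ha => ?_⟩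
    have has := hball ha
    obtain ⟨-, hm1, hm2⟩ := hprop a has
    have h3 : Γ a - a = X (m a) := by
      rw [hm2]
      conv_lhs => arg 2; rw [← hm1]
      module
    have hmt : ‖m a‖ ≤ 2 * ‖a‖ := by linarith [hma a has, norm_nonneg a]
    rw [h3]
    refine (norm_polyField_le _ _).trans ?_
    rw [mul_assoc, ← mul_pow]
    gcongr
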